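/- Let $(p_n)_{n\ge 1}$ be numbers in $(0,1]$. For each $n\ge 1$ let $\mathbb G(n,n,p_n)$ be the random bipartite graph with sides $A_n,B_n$ of size $n$ in which each of the $n^2$ pairs in $A_n\times B_n$ is an edge independently with probability $p_n$. Fix $a\in A_n$, $b\in B_n$, and let $G_n\sim\mathbb G(n,n,p_n)$ be conditioned on the edge $(a,b)$ being present. Let $\kappa_n(a,b)=1-W_1(m_a,m_b)$ be the Ollivier Ricci curvature of the edge $(a,b)$ in $G_n$, where $m_x$ is the uniform distribution on the neighbours of $x$ and $W_1(m_a,m_b)=\inf_\nu\sum_{u,v}\nu(u,v)\,d(u,v)$, the infimum being over all couplings $\nu$ of $m_a$ and $m_b$, with $d$ the shortest-path distance in $G_n$. Write $t_+=\max(t,0)$. Then, as $n\to\infty$: (a) If $np_n\to 0$, then with probability $1-o(1)$ the edge $(a,b)$ is isolated (that is, $a$ and $b$ have no other neighbours than each other), and with probability $1-o(1)$ one has $\kappa_n(a,b)=0$. (b) If $np_n\to\lambda$ with $0<\lambda<\infty$, then $$\kappa_n(a,b)\ \longrightarrow\ -2\left(1-\frac1{1+X_1}-\frac1{1+X_2}\right)_+\quad\text{in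 distribution},$$ where $X_1,X_2$ are independent Poisson($\lambda$) random variables. (c) If $np_n\to\infty$ and $np_n^2\to 0$, then $\kappa_n(a,b)\to -2$ in probability. (d) If $np_n^2\to\infty$, then $\kappa_n(a,b)\to 0$ in probability. -/

import Mathlib

open Filter Topology MeasureTheory ProbabilityTheory
open scoped unitInterval NNReal ENNReal

noncomputable section

namespace RicciRandomBipartite

/-- The transition probabilities `m_x` of the simple random walk on `G`: `m_x(y) = 1 / d_x` if `y`
is a neighbour of `x`, and `0` otherwise. -/
def walk {V : Type*} [Fintype V] (G : SimpleGraph V) (x y : V) : ℝ :=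
  open Classical in if G.Adj x y then 1 / (G.degree x : ℝ) else 0

/-- `ν` is a coupling of the one-step distributions `m_x` and `m_y` of the simple random walk. -/
def IsCoupling {V : Type*} [Fintype V] (G : SimpleGraph V) (x y : V) (ν : V → V → ℝ) : Prop :=
  (∀ u v, 0 ≤ ν u v) ∧ (∀ u, ∑ v, ν u v = walk G x u) ∧ (∀ v, ∑ u, ν u v = walk G y v)

/-- The transportation distance `W₁(m_x, m_y)` with respect to the graph distance, for an edge
`(x, y)`. A coupling of `m_x` and `m_y` vanishes off `N(x) × N(y)`, and for an edge `(x, y)` any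
two vertices of `N(x) ∪ N(y)` are joined by a path, so that `G.dist` is the length of a shortest
path wherever it enters with a nonzero weight, even if `G` is disconnected. -/
def W₁ {V : Type*} [Fintype V] (G : SimpleGraph V) (x y : V) : ℝ :=
  sInf {c : ℝ | ∃ ν : V → V → ℝ, IsCoupling G x y ν ∧ c = ∑ u, ∑ v, ν u v * (G.dist u v : ℝ)}

/-- Ollivier's coarse Ricci curvature `κ(x, y) = 1 - W₁(m_x, m_y)` of an edge `(x, y)` of `G`. -/
def ricci {V : Type*} [Fintype V] (G : SimpleGraph V) (x y : V) : ℝ :=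
  1 - W₁ G x y

/-- `{x, y}` is an isolated edge: `x` and `y` have no other neighbours than each other. -/
def IsolatedEdge {V : Type*} (G : SimpleGraph V) (x y : V) : Prop :=
  G.neighborSet x = {y} ∧ G.neighborSet y = {x}

/-- The law of the random bipartite graph with sides `A` and `B`: every pair in `A × B` is an edge
with probability `p`, independently. -/
def bipartiteLaw (A B : Type*) (p : I) : Measure (SimpleGraph (A ⊕ B)) :=
  (setBernoulli (completeBipartiteGraph A B).edgeSet p).map SimpleGraph.fromEdgeSet

/-- The law of `G(n, n, p)`, `0 < p ≤ 1`, conditioned on the presence of the edge `(a, b)`. -/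
def condLaw (n : ℕ) (a b : Fin n) (p : Set.Ioc (0 : ℝ) 1) :
    Measure (SimpleGraph (Fin n ⊕ Fin n)) :=
  ProbabilityTheory.cond (bipartiteLaw (Fin n) (Fin n) ⟨p, p.2.1.le, p.2.2⟩)
    {G | G.Adj (Sum.inl a) (Sum.inr b)}

instance instIsProbabilityMeasureBipartiteLaw (n : ℕ) (p : I) :
    IsProbabilityMeasure (bipartiteLaw (Fin n) (Fin n) p) :=
  Measure.isProbabilityMeasure_map SimpleGraph.measurable_fromEdgeSet.aemeasurable

instance instIsProbabilityMeasureCondLaw (n : ℕ) (a b : Fin n) (p : Set.Ioc (0 : ℝ) 1) :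
    IsProbabilityMeasure (condLaw n a b p) := by
  refine cond_isProbabilityMeasure fun h => ?_
  set q : I := ⟨p, p.2.1.le, p.2.2⟩ with hq
  set u := (completeBipartiteGraph (Fin n) (Fin n)).edgeSet with hu
  have h1 := Measure.le_map_apply
    (μ := setBernoulli u q) SimpleGraph.measurable_fromEdgeSet.aemeasurable
    {G : SimpleGraph (Fin n ⊕ Fin n) | G.Adj (Sum.inl a) (Sum.inr b)}
  have h2 : setBernoulli u q {u} = 0 := by
    refine measure_mono_null ?_ (le_antisymm (h1.trans h.le) (zero_le))
    rintro _ rfl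
    simp [hu]
  rw [setBernoulli_singleton q subset_rfl (Set.toFinite u)] at h2
  have h3 : unitInterval.toNNReal q ≠ 0 := by
    intro h0
    have : (q : ℝ) = 0 := by simpa using congrArg NNReal.toReal h0
    exact p.2.1.ne' this
  simp [h3] at h2

/-- Random variables `X n`, each on its own probability space, converge in probability to the
constant `c`. -/
def TendstoInProbConst {ι : Type*} {Ω : ι → Type*} {m : ∀ i, MeasurableSpace (Ω i)}
    (μ : (i : ι) → Measure (Ω i)) (X : (i : ι) → Ω i → ℝ) (l : Filter ι) (c : ℝ) : Prop :=
  ∀ ε : ℝ, 0 < ε → Tendsto (fun i => μ i {ω | ε ≤ |X i ω - c|}) l (𝓝 0)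

end RicciRandomBipartite

end

/-! In a bipartite graph a neighbour `u` of `x` and a neighbour `v` of `y` lie on opposite sides and
are joined by the walk u, x, y, v, so their distance is 1 or 3 (`dist_eq_three`). A coupling
therefore costs 3 minus twice the mass it puts on edges (`IsCoupling.cost_eq`), and the curvature is
-2(1 - m), where m is the largest mass of m_x that can be moved to m_y along single edges.
Everything reduces to estimating m.

Two sources supply that mass. The edges at `x` or `y` always carry min(1, 1/d_x + 1/d_y)
(`neg_two_mul_max_le_ricci`). Beyond them there are only the cross edges, between the other
neighbours of `x` and those of `y`, and each carries at most 1/d_x (`ricci_le_crossEdges`). Given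
(a, b), the remaining pairs are still independent with probability p, so the expected number of
cross edges is (n-1)²p³.

If np → 0, Markov's inequality makes both extra degrees vanish. If np → λ, there are no cross edges
with high probability, the curvature is an exact function of the two degrees, and these are
independent binomials with Poisson limits. If np → ∞ and np² → 0, the degrees concentrate near np
and the cross edges contribute about n²p³/(np) = np² → 0, so m → 0.

If np² → ∞, equal weight on all cross edges is almost a coupling: each neighbour of `a` lies on
about np² of them, up to an error of order √(np²), by a second moment bound. `le_ricci_of_weight`
turns this approximate coupling into a curvature bound. -/

namespace RicciRandomBipartite

/-! ### Curvature of an edge in a two-colourable graph -/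

section Deterministic

lemma dist_eq_three {V : Type*} {G : SimpleGraph V} {x y : V} (c : G.Coloring Bool) (h : G.Adj x y)
    {u v : V} (hu : G.Adj x u) (hv : G.Adj y v) (huv : ¬ G.Adj u v) : G.dist u v = 3 := by
  let w : G.Walk u v := .cons hu.symm (.cons h (.cons hv .nil))
  have hle : G.dist u v ≤ 3 := SimpleGraph.dist_le w
  obtain ⟨q, hq⟩ := w.reachable.exists_walk_length_eq_dist
  -- All walks between two given vertices of a two-coloured graph have lengths of the same parity,
  -- and `w` has length 3. This also rules out `u = v`.
  have hodd : Odd (G.dist u v) := by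
    rw [← hq, c.odd_length_iff_not_congr q, ← c.odd_length_iff_not_congr w]
    exact ⟨1, rfl⟩
  have h1 : G.dist u v ≠ 1 := fun h1 => huv (SimpleGraph.dist_eq_one_iff_adj.1 h1)
  obtain ⟨k, hk⟩ := hodd
  omega

variable {V : Type*} [Fintype V] {G : SimpleGraph V} {x y : V}

lemma walk_of_adj {u : V} (h : G.Adj x u) : walk G x u = 1 / ((G.neighborSet x).ncard : ℝ) := by
  classical
  have : (G.neighborSet x).ncard = G.degree x := by
    rw [← SimpleGraph.card_neighborFinset_eq_degree, ← Set.ncard_coe_finset, G.coe_neighborFinset]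
  rw [walk, if_pos h, this]

lemma walk_of_not_adj {u : V} (h : ¬ G.Adj x u) : walk G x u = 0 := by
  rw [walk, if_neg h]

lemma walk_nonneg (G : SimpleGraph V) (x u : V) : 0 ≤ walk G x u := by
  unfold walk
  split_ifs <;> positivity

lemma ncard_neighborSet_pos (h : G.Adj x y) : 0 < (G.neighborSet x).ncard :=
  (Set.ncard_pos (Set.toFinite _)).2 ⟨y, h⟩

lemma sum_walk (h : G.Adj x y) : ∑ u, walk G x u = 1 := by
  classical
  have hd : ((G.neighborSet x).ncard : ℝ) ≠ 0 := by
    exact_mod_cast (ncard_neighborSet_pos h).ne'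
  have : ∀ u, walk G x u =
      if u ∈ G.neighborFinset x then 1 / ((G.neighborSet x).ncard : ℝ) else 0 := by
    intro u
    by_cases hu : G.Adj x u
    · simp [walk_of_adj hu, hu]
    · simp [walk_of_not_adj hu, hu]
  simp_rw [this]
  rw [Finset.sum_ite_mem, Finset.univ_inter, Finset.sum_const, nsmul_eq_mul,
    ← Set.ncard_coe_finset, G.coe_neighborFinset, mul_one_div_cancel hd]

open Classical in
lemma sum_walk_erase (h : G.Adj x y) :
    ∑ u, (if u = y then 0 else walk G x u) = 1 - walk G x y := by
  rw [← sum_walk h, ← Finset.sum_erase_eq_sub (Finset.mem_univ y), ← Finset.filter_ne',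
    Finset.sum_filter]
  exact Finset.sum_congr rfl fun u _ => by simp

open Classical in
/-- The mass that `ν` puts on pairs of adjacent vertices. -/
noncomputable def adjMass (G : SimpleGraph V) (ν : V → V → ℝ) : ℝ :=
  ∑ u, ∑ v, if G.Adj u v then ν u v else 0

lemma IsCoupling.le_walk_left {ν : V → V → ℝ} (hν : IsCoupling G x y ν) (u v : V) :
    ν u v ≤ walk G x u := by
  rw [← hν.2.1 u]
  exact Finset.single_le_sum (f := fun v => ν u v) (fun v _ => hν.1 u v) (Finset.mem_univ v)

lemma IsCoupling.le_walk_right {ν : V → V → ℝ} (hν : IsCoupling G x y ν) (u v : V) :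
    ν u v ≤ walk G y v := by
  rw [← hν.2.2 v]
  exact Finset.single_le_sum (f := fun u => ν u v) (fun u _ => hν.1 u v) (Finset.mem_univ u)

lemma IsCoupling.sum_eq_one {ν : V → V → ℝ} (hν : IsCoupling G x y ν) (h : G.Adj x y) :
    ∑ u, ∑ v, ν u v = 1 := by
  simp_rw [hν.2.1]
  exact sum_walk h

lemma IsCoupling.cost_eq {ν : V → V → ℝ} (hν : IsCoupling G x y ν) (c : G.Coloring Bool)
    (h : G.Adj x y) :
    ∑ u, ∑ v, ν u v * (G.dist u v : ℝ) = 3 - 2 * adjMass G ν := by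
  classical
  have key : ∀ u v, ν u v * (G.dist u v : ℝ) =
      3 * ν u v - 2 * (if G.Adj u v then ν u v else 0) := by
    intro u v
    split_ifs with huv
    · rw [SimpleGraph.dist_eq_one_iff_adj.2 huv]
      push_cast
      ring
    · by_cases h0 : ν u v = 0
      · simp [h0]
      · have hpos : 0 < ν u v := lt_of_le_of_ne (hν.1 u v) (Ne.symm h0)
        have hu : G.Adj x u := by
          by_contra hu
          have := hν.le_walk_left u v
          rw [walk_of_not_adj hu] at this
          linarith
        have hv : G.Adj y v := by
          by_contra hv
          have := hν.le_walk_right u v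
          rw [walk_of_not_adj hv] at this
          linarith
        rw [dist_eq_three c h hu hv huv]
        push_cast
        ring
  simp_rw [key, Finset.sum_sub_distrib, ← Finset.mul_sum, hν.sum_eq_one h, mul_one]
  unfold adjMass
  congr!

lemma isCoupling_mul (h : G.Adj x y) : IsCoupling G x y fun u v => walk G x u * walk G y v := by
  refine ⟨fun u v => mul_nonneg (walk_nonneg ..) (walk_nonneg ..), fun u => ?_, fun v => ?_⟩
  · rw [← Finset.mul_sum, sum_walk h.symm, mul_one]
  · rw [← Finset.sum_mul, sum_walk h, one_mul]

lemma ricci_le_of_forall_adjMass_le (c : G.Coloring Bool) (h : G.Adj x y) {M : ℝ}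
    (hM : ∀ ν, IsCoupling G x y ν → adjMass G ν ≤ M) : ricci G x y ≤ -2 * (1 - M) := by
  have : 3 - 2 * M ≤ W₁ G x y := by
    refine le_csInf ⟨_, _, isCoupling_mul h, rfl⟩ ?_
    rintro _ ⟨ν, hν, rfl⟩
    rw [hν.cost_eq c h]
    linarith [hM ν hν]
  unfold ricci
  linarith

lemma IsCoupling.le_ricci {ν : V → V → ℝ} (hν : IsCoupling G x y ν) (c : G.Coloring Bool)
    (h : G.Adj x y) : -2 * (1 - adjMass G ν) ≤ ricci G x y := by
  have : W₁ G x y ≤ 3 - 2 * adjMass G ν := by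
    refine csInf_le ⟨0, ?_⟩ ⟨ν, hν, (hν.cost_eq c h).symm⟩
    rintro _ ⟨ν, hν, rfl⟩
    exact Finset.sum_nonneg fun u _ => Finset.sum_nonneg fun v _ =>
      mul_nonneg (hν.1 u v) (Nat.cast_nonneg _)
  unfold ricci
  linarith

/-- The row deficits `ρ` and column deficits `τ` have the same total 1 - M, so adding the product
plan ρ ⊗ τ / (1 - M) repairs both marginals at once. -/
lemma exists_isCoupling_ge {ξ : V → V → ℝ} (h : G.Adj x y) (h0 : ∀ u v, 0 ≤ ξ u v)
    (hr : ∀ u, ∑ v, ξ u v ≤ walk G x u) (hc : ∀ v, ∑ u, ξ u v ≤ walk G y v) :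
    ∃ ν, IsCoupling G x y ν ∧ ∀ u v, ξ u v ≤ ν u v := by
  set M := ∑ u, ∑ v, ξ u v with hM
  have hM' : M = ∑ v, ∑ u, ξ u v := Finset.sum_comm
  set ρ : V → ℝ := fun u => walk G x u - ∑ v, ξ u v with hρ
  set τ : V → ℝ := fun v => walk G y v - ∑ u, ξ u v with hτ
  have hρ0 : ∀ u, 0 ≤ ρ u := fun u => sub_nonneg.2 (hr u)
  have hτ0 : ∀ v, 0 ≤ τ v := fun v => sub_nonneg.2 (hc v)
  have hρs : ∑ u, ρ u = 1 - M := by rw [hρ, Finset.sum_sub_distrib, sum_walk h]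
  have hτs : ∑ v, τ v = 1 - M := by rw [hτ, Finset.sum_sub_distrib, sum_walk h.symm, hM']
  have hM1 : 0 ≤ 1 - M := hρs ▸ Finset.sum_nonneg fun u _ => hρ0 u
  refine ⟨fun u v => ξ u v + ρ u * τ v / (1 - M), ⟨fun u v => ?_, fun u => ?_, fun v => ?_⟩,
    fun u v => ?_⟩
  · have := h0 u v
    have := hρ0 u
    have := hτ0 v
    positivity
  · rw [Finset.sum_add_distrib, ← Finset.sum_div, ← Finset.mul_sum, hτs]
    -- If M = 1 the correction is a division by zero, hence 0; this is right because all deficits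
    -- vanish.
    rcases hM1.eq_or_lt with h1 | h1
    · have : ρ u = 0 := (Finset.sum_eq_zero_iff_of_nonneg fun u _ => hρ0 u).1
        (hρs.trans h1.symm) u (Finset.mem_univ u)
      simp only [this, zero_mul, zero_div, add_zero]
      linarith [show ρ u = walk G x u - ∑ v, ξ u v from rfl]
    · rw [mul_div_cancel_right₀ _ h1.ne']
      simp [hρ]
  · rw [Finset.sum_add_distrib, ← Finset.sum_div, ← Finset.sum_mul, hρs]
    rcases hM1.eq_or_lt with h1 | h1
    · have : τ v = 0 := (Finset.sum_eq_zero_iff_of_nonneg fun u _ => hτ0 u).1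
        (hτs.trans h1.symm) v (Finset.mem_univ v)
      simp only [this, mul_zero, zero_div, add_zero]
      linarith [show τ v = walk G y v - ∑ u, ξ u v from rfl]
    · rw [mul_div_cancel_left₀ _ h1.ne']
      simp [hτ]
  · have := hρ0 u
    have := hτ0 v
    have : 0 ≤ ρ u * τ v / (1 - M) := by positivity
    simpa using this

/-- A partial transport plan of mass `M` along edges bounds the curvature from below by
`-2 * (1 - M)`. -/
lemma le_ricci_of_partial {ξ : V → V → ℝ} (c : G.Coloring Bool) (h : G.Adj x y)
    (h0 : ∀ u v, 0 ≤ ξ u v) (hadj : ∀ u v, ¬ G.Adj u v → ξ u v = 0)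
    (hr : ∀ u, ∑ v, ξ u v ≤ walk G x u) (hc : ∀ v, ∑ u, ξ u v ≤ walk G y v) :
    -2 * (1 - ∑ u, ∑ v, ξ u v) ≤ ricci G x y := by
  classical
  obtain ⟨ν, hν, hξ⟩ := exists_isCoupling_ge h h0 hr hc
  have : ∑ u, ∑ v, ξ u v ≤ adjMass G ν := by
    refine Finset.sum_le_sum fun u _ => Finset.sum_le_sum fun v _ => ?_
    split_ifs with huv
    · exact hξ u v
    · exact (hadj u v huv).le
  linarith [hν.le_ricci c h]

lemma neg_two_le_ricci (c : G.Coloring Bool) (h : G.Adj x y) : -2 ≤ ricci G x y := by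
  have := le_ricci_of_partial (ξ := fun _ _ => 0) c h (by simp) (by simp)
    (by simpa using walk_nonneg G x) (by simpa using walk_nonneg G y)
  simpa using this

lemma ricci_nonpos (c : G.Coloring Bool) (h : G.Adj x y) : ricci G x y ≤ 0 := by
  classical
  have := ricci_le_of_forall_adjMass_le c h (M := 1) fun ν hν => by
    rw [← hν.sum_eq_one h]
    refine Finset.sum_le_sum fun u _ => Finset.sum_le_sum fun v _ => ?_
    split_ifs
    exacts [le_rfl, hν.1 u v]
  simpa using this

/-- Any nonnegative weight along edges bounds the curvature from below in terms of the distance of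
its marginals from the one-step distributions. -/
lemma le_ricci_of_weight {ξ : V → V → ℝ} (c : G.Coloring Bool) (h : G.Adj x y)
    (h0 : ∀ u v, 0 ≤ ξ u v) (hadj : ∀ u v, ¬ G.Adj u v → ξ u v = 0) :
    -2 * (∑ u, |∑ v, ξ u v - walk G x u| + ∑ v, |∑ u, ξ u v - walk G y v|) ≤ ricci G x y := by
  -- Rows and columns that exceed their target are shrunk to it, by factors `α` and `β`; the others
  -- are left alone.
  have scale : ∀ r m : ℝ, 0 ≤ r → 0 ≤ m →
      ∃ t : ℝ, 0 ≤ t ∧ t ≤ 1 ∧ t * r = min r m := by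
    intro r m hr hm
    rcases le_or_gt r m with hrm | hrm
    · exact ⟨1, zero_le_one, le_rfl, by rw [one_mul, min_eq_left hrm]⟩
    · have hr' : 0 < r := hm.trans_lt hrm
      exact ⟨m / r, by positivity, (div_le_one hr').2 hrm.le,
        by rw [div_mul_cancel₀ _ hr'.ne', min_eq_right hrm.le]⟩
  choose α hα0 hα1 hα using fun u => scale (∑ v, ξ u v) (walk G x u)
    (Finset.sum_nonneg fun v _ => h0 u v) (walk_nonneg ..)
  choose β hβ0 hβ1 hβ using fun v => scale (∑ u, ξ u v) (walk G y v)
    (Finset.sum_nonneg fun u _ => h0 u v) (walk_nonneg ..)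
  have key := le_ricci_of_partial (ξ := fun u v => ξ u v * (α u * β v)) c h
    (fun u v => mul_nonneg (h0 u v) (mul_nonneg (hα0 u) (hβ0 v)))
    (fun u v huv => by simp [hadj u v huv])
    (fun u => by
      calc ∑ v, ξ u v * (α u * β v) ≤ ∑ v, α u * ξ u v := by
            refine Finset.sum_le_sum fun v _ => ?_
            nlinarith [mul_nonneg (mul_nonneg (h0 u v) (hα0 u)) (sub_nonneg.2 (hβ1 v))]
        _ ≤ walk G x u := by
            rw [← Finset.mul_sum, hα]
            exact min_le_right _ _)
    (fun v => by
      calc ∑ u, ξ u v * (α u * β v) ≤ ∑ u, β v * ξ u v := by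
            refine Finset.sum_le_sum fun u _ => ?_
            nlinarith [mul_nonneg (mul_nonneg (h0 u v) (hβ0 v)) (sub_nonneg.2 (hα1 u))]
        _ ≤ walk G y v := by
            rw [← Finset.mul_sum, hβ]
            exact min_le_right _ _)
  -- This is αβ ≥ α + β - 1, that is (1 - α)(1 - β) ≥ 0, summed against `ξ`. The total mass of `ξ`
  -- cancels against the one in `h2`, so `ξ` need not be normalised.
  have hsplit : ∑ u, α u * ∑ v, ξ u v + ∑ v, β v * ∑ u, ξ u v - ∑ v, ∑ u, ξ u v
      ≤ ∑ u, ∑ v, ξ u v * (α u * β v) := by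
    simp_rw [Finset.mul_sum]
    rw [Finset.sum_comm (f := fun v u => β v * ξ u v), Finset.sum_comm (f := fun v u => ξ u v),
      ← Finset.sum_add_distrib, ← Finset.sum_sub_distrib]
    refine Finset.sum_le_sum fun u _ => ?_
    rw [← Finset.sum_add_distrib, ← Finset.sum_sub_distrib]
    refine Finset.sum_le_sum fun v _ => ?_
    nlinarith [mul_nonneg (h0 u v) (mul_nonneg (sub_nonneg.2 (hα1 u)) (sub_nonneg.2 (hβ1 v)))]
  simp_rw [hα, hβ] at hsplit
  have h1 : 1 - ∑ u, |∑ v, ξ u v - walk G x u| ≤ ∑ u, min (∑ v, ξ u v) (walk G x u) := by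
    rw [← sum_walk h, ← Finset.sum_sub_distrib]
    refine Finset.sum_le_sum fun u _ => le_min ?_ ?_
    · linarith [neg_abs_le (∑ v, ξ u v - walk G x u)]
    · linarith [abs_nonneg (∑ v, ξ u v - walk G x u)]
  have h2 : ∑ v, ∑ u, ξ u v - ∑ v, |∑ u, ξ u v - walk G y v|
      ≤ ∑ v, min (∑ u, ξ u v) (walk G y v) := by
    rw [← Finset.sum_sub_distrib]
    refine Finset.sum_le_sum fun v _ => le_min ?_ ?_
    · linarith [abs_nonneg (∑ u, ξ u v - walk G y v)]
    · linarith [le_abs_self (∑ u, ξ u v - walk G y v)]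
  linarith

open Classical in
/-- The number of edges joining a neighbour of `x` to a neighbour of `y`, other than those through
`x` or `y`. -/
noncomputable def crossEdges (G : SimpleGraph V) (x y : V) : ℝ :=
  ∑ u, ∑ v, if u ≠ y ∧ v ≠ x ∧ G.Adj x u ∧ G.Adj u v ∧ G.Adj y v then 1 else 0

/-- The mass of a coupling on edges lies in the row of `y` (total 1/d_x), in the column of `x`
(total 1/d_y), or on cross edges, where each entry is at most its row sum 1/d_x. -/
lemma ricci_le_crossEdges (c : G.Coloring Bool) (h : G.Adj x y) :
    ricci G x y ≤ -2 * (1 - (1 / ((G.neighborSet x).ncard : ℝ) + 1 / ((G.neighborSet y).ncard : ℝ)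
      + crossEdges G x y / ((G.neighborSet x).ncard : ℝ))) := by
  classical
  refine ricci_le_of_forall_adjMass_le c h fun ν hν => ?_
  have key : ∀ u v, (if G.Adj u v then ν u v else 0) ≤
      (if u = y then ν u v else 0) + (if v = x then ν u v else 0) +
      (if u ≠ y ∧ v ≠ x ∧ G.Adj x u ∧ G.Adj u v ∧ G.Adj y v then 1 else 0) *
        (1 / ((G.neighborSet x).ncard : ℝ)) := by
    intro u v
    have h0 := hν.1 u v
    have hd : (0 : ℝ) ≤ 1 / ((G.neighborSet x).ncard : ℝ) := by positivity
    by_cases hu : u = y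
    · simp only [hu, if_true] at h0 ⊢
      split_ifs <;> simp_all
    by_cases hv : v = x
    · simp only [hv, if_true] at h0 ⊢
      split_ifs <;> simp_all
    by_cases hxu : G.Adj x u
    · by_cases hyv : G.Adj y v
      · have := hν.le_walk_left u v
        rw [walk_of_adj hxu] at this
        by_cases huv : G.Adj u v
        · simpa [hu, hv, hxu, hyv, huv] using this
        · simp [hu, hv, huv]
      · have := hν.le_walk_right u v
        rw [walk_of_not_adj hyv] at this
        have : ν u v = 0 := le_antisymm this h0
        simp [this, hu, hv, hyv]
    · have := hν.le_walk_left u v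
      rw [walk_of_not_adj hxu] at this
      have : ν u v = 0 := le_antisymm this h0
      simp [this, hu, hv, hxu]
  calc adjMass G ν ≤ ∑ u, ∑ v, ((if u = y then ν u v else 0) + (if v = x then ν u v else 0) +
      (if u ≠ y ∧ v ≠ x ∧ G.Adj x u ∧ G.Adj u v ∧ G.Adj y v then 1 else 0) *
        (1 / ((G.neighborSet x).ncard : ℝ))) :=
        Finset.sum_le_sum fun u _ => Finset.sum_le_sum fun v _ => key u v
    _ = _ := by
        simp_rw [Finset.sum_add_distrib, ← Finset.sum_mul]
        rw [Finset.sum_comm (f := fun u v => if u = y then ν u v else 0)]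
        simp only [Finset.sum_ite_eq', Finset.mem_univ, if_true]
        rw [hν.2.1, hν.2.2, walk_of_adj h, walk_of_adj h.symm, mul_one_div]
        rfl

/-- Transport along the edges at `x` and `y` alone. -/
lemma le_ricci_of_star (c : G.Coloring Bool) (h : G.Adj x y) {f g : V → ℝ}
    (hf0 : ∀ v, 0 ≤ f v) (hg0 : ∀ u, 0 ≤ g u)
    (hf : ∀ v, v ≠ x → f v ≤ walk G y v) (hg : ∀ u, u ≠ y → g u ≤ walk G x u)
    (hfx : f x + ∑ u, g u ≤ walk G y x) (hgy : g y + ∑ v, f v ≤ walk G x y) :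
    -2 * (1 - (∑ v, f v + ∑ u, g u)) ≤ ricci G x y := by
  classical
  have hfadj : ∀ v, ¬ G.Adj y v → f v = 0 := fun v hv => by
    have hvx : v ≠ x := by rintro rfl; exact hv h.symm
    exact le_antisymm ((hf v hvx).trans (walk_of_not_adj hv).le) (hf0 v)
  have hgadj : ∀ u, ¬ G.Adj x u → g u = 0 := fun u hu => by
    have hvx : u ≠ y := by rintro rfl; exact hu h
    exact le_antisymm ((hg u hvx).trans (walk_of_not_adj hu).le) (hg0 u)
  -- Here `f v` travels from `y` to `v` and `g u` from `u` to `x`; the pair (y, x) may receive both.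
  have key := le_ricci_of_partial
    (ξ := fun u v => (if u = y then f v else 0) + (if v = x then g u else 0)) c h
    (fun u v => by
      have := hf0 v
      have := hg0 u
      split_ifs <;> positivity)
    (fun u v huv => by
      have h1 : (if u = y then f v else 0) = 0 := by
        split_ifs with hu
        · exact hfadj v (hu ▸ huv)
        · rfl
      have h2 : (if v = x then g u else 0) = 0 := by
        split_ifs with hv
        · exact hgadj u fun h' => huv (hv ▸ h'.symm)
        · rfl
      simp [h1, h2])
    (fun u => by
      simp only [Finset.sum_add_distrib, Finset.sum_ite_eq', Finset.mem_univ, if_true]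
      by_cases hu : u = y
      · subst hu
        simpa [add_comm] using hgy
      · simpa [hu] using hg u hu)
    (fun v => by
      simp only [Finset.sum_add_distrib, Finset.sum_ite_eq', Finset.mem_univ, if_true]
      by_cases hv : v = x
      · subst hv
        simpa [add_comm] using hfx
      · simpa [hv] using hf v hv)
  simp only [Finset.sum_add_distrib, Finset.sum_ite_eq', Finset.mem_univ, if_true] at key
  rw [Finset.sum_comm (f := fun u v => if u = y then f v else 0)] at key
  simpa using key

/-- The mass 1/d_x at `y` can be sent to neighbours of `y`, and the demand 1/d_y at `x` can be met
from neighbours of `x`. Together with the upper bound this is sharp when there are no cross edges.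
-/
lemma neg_two_mul_max_le_ricci (c : G.Coloring Bool) (h : G.Adj x y) :
    -2 * max (1 - 1 / ((G.neighborSet x).ncard : ℝ) - 1 / ((G.neighborSet y).ncard : ℝ)) 0
      ≤ ricci G x y := by
  classical
  set dx := (G.neighborSet x).ncard with hdx
  set dy := (G.neighborSet y).ncard with hdy
  have hx : 0 < dx := ncard_neighborSet_pos h
  have hy : 0 < dy := ncard_neighborSet_pos h.symm
  have wx : walk G x y = 1 / (dx : ℝ) := walk_of_adj h
  have wy : walk G y x = 1 / (dy : ℝ) := walk_of_adj h.symm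
  have sx := sum_walk h
  have sy := sum_walk h.symm
  have sx' := sum_walk_erase h
  rw [wx] at sx'
  have sy' := sum_walk_erase h.symm
  rw [wy] at sy'
  have hdx1 : 1 / (dx : ℝ) ≤ 1 := by
    rw [div_le_one (by positivity)]
    exact_mod_cast hx
  have hdy1 : 1 / (dy : ℝ) ≤ 1 := by
    rw [div_le_one (by positivity)]
    exact_mod_cast hy
  -- If `x` has degree 1, then m_x is the point mass at `y`, which is adjacent to the whole support
  -- of m_y: all mass moves along edges. The case of `y` is symmetric.
  rcases eq_or_lt_of_le (Nat.succ_le_of_lt hx) with h1 | h1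
  · have := le_ricci_of_star c h (f := walk G y) (g := 0) (walk_nonneg G y) (by simp)
      (by simp) (by simpa using fun u _ => walk_nonneg G x u) (by simp) (by simp [sy, wx, ← h1])
    rw [sy] at this
    refine le_trans ?_ this
    simp
  rcases eq_or_lt_of_le (Nat.succ_le_of_lt hy) with h2 | h2
  · have := le_ricci_of_star c h (f := 0) (g := walk G x) (by simp) (walk_nonneg G x)
      (by simpa using fun u _ => walk_nonneg G y u) (by simp) (by simp [sx, wy, ← h2]) (by simp)
    rw [sx] at this
    refine le_trans ?_ this
    simp
  have h1' : (2 : ℝ) ≤ dx := by exact_mod_cast h1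
  have h2' : (2 : ℝ) ≤ dy := by exact_mod_cast h2
  have i1 : 1 / (dx : ℝ) ≤ 1 / 2 := one_div_le_one_div_of_le two_pos h1'
  have i2 : 1 / (dy : ℝ) ≤ 1 / 2 := one_div_le_one_div_of_le two_pos h2'
  have j1 : 0 < 1 / (dx : ℝ) := by positivity
  have j2 : 0 < 1 / (dy : ℝ) := by positivity
  generalize 1 / (dx : ℝ) = r at *
  generalize 1 / (dy : ℝ) = t at *
  have hr : 0 < 1 - r := by linarith
  have ht : 0 < 1 - t := by linarith
  -- With both degrees at least 2, the mass r = 1/d_x at `y` is spread over the neighbours of `y`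
  -- other than `x`, which can absorb 1 - t ≥ 1/2 ≥ r. The edge (y, x) itself is not used, so the
  -- two flows do not compete.
  have a1 : r / (1 - t) ≤ 1 := (div_le_one ht).2 (by linarith)
  have a2 : t / (1 - r) ≤ 1 := (div_le_one hr).2 (by linarith)
  have b1 : 0 ≤ r / (1 - t) := by positivity
  have b2 : 0 ≤ t / (1 - r) := by positivity
  have s1 : ∑ v, r / (1 - t) * (if v = x then 0 else walk G y v) = r := by
    rw [← Finset.mul_sum, sy', div_mul_cancel₀ _ ht.ne']
  have s2 : ∑ u, t / (1 - r) * (if u = y then 0 else walk G x u) = t := by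
    rw [← Finset.mul_sum, sx', div_mul_cancel₀ _ hr.ne']
  have := le_ricci_of_star c h (f := fun v => r / (1 - t) * (if v = x then 0 else walk G y v))
    (g := fun u => t / (1 - r) * (if u = y then 0 else walk G x u))
    (fun v => mul_nonneg b1 (by split_ifs; exacts [le_rfl, walk_nonneg ..]))
    (fun v => mul_nonneg b2 (by split_ifs; exacts [le_rfl, walk_nonneg ..]))
    (fun v hv => by simpa [hv] using mul_le_of_le_one_left (walk_nonneg G y v) a1)
    (fun u hu => by simpa [hu] using mul_le_of_le_one_left (walk_nonneg G x u) a2)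
    (by rw [s2, wy]; simp) (by rw [s1, wx]; simp)
  rw [s1, s2] at this
  refine le_trans ?_ this
  have := le_max_left (1 - r - t) 0
  linarith

end Deterministic

/-! ### The conditioned law and its cylinder events -/

section Law

/-- With finitely many vertices every set of graphs is measurable, which disposes of all
measurability and integrability conditions on random graphs below. -/
instance instDiscreteMeasurableSpaceSimpleGraph {V : Type*} [Finite V] :
    DiscreteMeasurableSpace (SimpleGraph V) := by
  have : MeasurableSingletonClass (SimpleGraph V) := by
    refine ⟨fun G => ?_⟩
    have : ({G} : Set (SimpleGraph V)) = SimpleGraph.edgeSet ⁻¹' {G.edgeSet} := by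
      ext H
      simp
    rw [this]
    exact SimpleGraph.measurable_edgeSet (measurableSet_singleton _)
  infer_instance

/-- The pairs in `F` are edges of `G`, those in `F'` are not. -/
def boxEvent (A B : Type*) (F F' : Finset (A × B)) : Set (SimpleGraph (A ⊕ B)) :=
  {G | (∀ e ∈ F, G.Adj (Sum.inl e.1) (Sum.inr e.2)) ∧ ∀ e ∈ F', ¬ G.Adj (Sum.inl e.1) (Sum.inr e.2)}

lemma bipartiteLaw_boxEvent {n : ℕ} (q : I) {F F' : Finset (Fin n × Fin n)} (hF : Disjoint F F') :
    bipartiteLaw (Fin n) (Fin n) q (boxEvent (Fin n) (Fin n) F F') =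
      (unitInterval.toNNReal q : ℝ≥0∞) ^ F.card *
        (unitInterval.toNNReal (σ q) : ℝ≥0∞) ^ F'.card := by
  classical
  let edge : Fin n × Fin n → Sym2 (Fin n ⊕ Fin n) := fun e => s(Sum.inl e.1, Sum.inr e.2)
  have hinj : Function.Injective edge := by
    rintro ⟨i, j⟩ ⟨i', j'⟩ h
    simpa [edge] using h
  -- In the product space behind `setBernoulli` the event is a cylinder: it fixes the coordinates in
  -- F ∪ F' and no others.
  have hset : (fun P : Sym2 (Fin n ⊕ Fin n) → Prop => {i | P i}) ⁻¹'
      (SimpleGraph.fromEdgeSet ⁻¹' boxEvent (Fin n) (Fin n) F F') =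
      Set.pi ((F ∪ F').image edge : Finset (Sym2 (Fin n ⊕ Fin n)))
        (fun e => if e ∈ F.image edge then {True} else {False}) := by
    ext P
    have hd : ∀ e ∈ F', e ∉ F := fun e he he' => Finset.disjoint_left.1 hF he' he
    simp only [boxEvent, Set.mem_preimage, Set.mem_ofPred_eq, SimpleGraph.fromEdgeSet_adj, ne_eq,
      reduceCtorEq, not_false_eq_true, and_true, Set.mem_pi, Finset.mem_coe, Finset.mem_image,
      Finset.mem_union, forall_exists_index, and_imp, forall_apply_eq_imp_iff₂]
    constructor
    · rintro ⟨h1, h2⟩ e (he | he)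
      · rw [if_pos ⟨e, he, rfl⟩]
        simpa using h1 e he
      · rw [if_neg]
        · simpa using h2 e he
        · rintro ⟨e', he', h⟩
          exact hd e he (hinj h ▸ he')
    · intro h
      refine ⟨fun e he => ?_, fun e he => ?_⟩
      · have := h e (.inl he)
        rw [if_pos ⟨e, he, rfl⟩] at this
        simpa using this
      · have := h e (.inr he)
        rw [if_neg] at this
        · simpa using this
        · rintro ⟨e', he', h⟩
          exact hd e he (hinj h ▸ he')
  rw [bipartiteLaw, Measure.map_apply SimpleGraph.measurable_fromEdgeSet .of_discrete,
    setBernoulli_apply', hset, Measure.infinitePi_pi _ (fun _ _ => .of_discrete),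
    Finset.prod_image hinj.injOn, Finset.prod_union hF]
  congr 1
  · rw [← Finset.prod_const]
    refine Finset.prod_congr rfl fun e he => ?_
    rw [if_pos (Finset.mem_image_of_mem _ he)]
    simp [edge]
  · rw [← Finset.prod_const]
    refine Finset.prod_congr rfl fun e he => ?_
    rw [if_neg]
    · simp [edge]
    · intro h
      obtain ⟨e', he', h⟩ := Finset.mem_image.1 h
      exact Finset.disjoint_left.1 hF he' (hinj h ▸ he)

variable {n : ℕ} {a b : Fin n} {p : Set.Ioc (0 : ℝ) 1}

/-- Conditioning on (a, b) adds one prescribed edge to the box, and dividing by p removes its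
factor. This is the only place where the conditioned probabilities are computed; all moments and
point masses follow from it. -/
lemma condLaw_boxEvent {F F' : Finset (Fin n × Fin n)} (hF : Disjoint F F')
    (h1 : (a, b) ∉ F) (h2 : (a, b) ∉ F') :
    (condLaw n a b p).real (boxEvent (Fin n) (Fin n) F F') =
      (p : ℝ) ^ F.card * (1 - (p : ℝ)) ^ F'.card := by
  classical
  set q : I := ⟨p, p.2.1.le, p.2.2⟩ with hq
  have e1 : {G : SimpleGraph (Fin n ⊕ Fin n) | G.Adj (Sum.inl a) (Sum.inr b)} =
      boxEvent (Fin n) (Fin n) {(a, b)} ∅ := by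
    ext G
    simp [boxEvent]
  have e2 : boxEvent (Fin n) (Fin n) {(a, b)} ∅ ∩ boxEvent (Fin n) (Fin n) F F' =
      boxEvent (Fin n) (Fin n) (insert (a, b) F) F' := by
    ext G
    simp [boxEvent, and_assoc]
  have hq0 : (p : ℝ) ≠ 0 := p.2.1.ne'
  rw [condLaw, measureReal_def, cond_apply .of_discrete, e1, e2, bipartiteLaw_boxEvent q (by simp),
    bipartiteLaw_boxEvent q (by simp [hF, h2]), Finset.card_insert_of_notMem h1]
  simp only [ENNReal.toReal_mul, ENNReal.toReal_inv, ENNReal.toReal_pow, ENNReal.coe_toReal,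
    unitInterval.coe_toNNReal, unitInterval.coe_symm_eq]
  simp only [hq, Finset.card_singleton, Finset.card_empty, pow_one, pow_zero, mul_one]
  field_simp
  ring

lemma condLaw_ae : ∀ᵐ G ∂(condLaw n a b p),
    G.Adj (Sum.inl a) (Sum.inr b) ∧ G ≤ completeBipartiteGraph (Fin n) (Fin n) := by
  have h1 : ∀ᵐ G ∂(condLaw n a b p), G.Adj (Sum.inl a) (Sum.inr b) :=
    ae_cond_mem .of_discrete
  have h2 : ∀ᵐ G ∂(bipartiteLaw (Fin n) (Fin n) ⟨p, p.2.1.le, p.2.2⟩),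
      G ≤ completeBipartiteGraph (Fin n) (Fin n) := by
    rw [bipartiteLaw, ae_map_iff SimpleGraph.measurable_fromEdgeSet.aemeasurable .of_discrete]
    filter_upwards [setBernoulli_ae_subset] with s hs
    intro u v huv
    rw [SimpleGraph.fromEdgeSet_adj] at huv
    exact hs huv.1
  exact h1.and (cond_absolutelyContinuous.ae_le h2)

/-- The two-colouring of a bipartite graph. -/
def sideColoring {A B : Type*} {G : SimpleGraph (A ⊕ B)} (hG : G ≤ completeBipartiteGraph A B) :
    G.Coloring Bool :=
  SimpleGraph.Coloring.mk Sum.isLeft fun {u v} huv => by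
    have := hG huv
    cases u <;> cases v <;> simp_all

end Law

/-! ### Curvature bounds in terms of edge indicators -/

section Counts

variable {n : ℕ}

open Classical in
/-- The indicator of the pair `e` being an edge. -/
noncomputable def ind (e : Fin n × Fin n) (G : SimpleGraph (Fin n ⊕ Fin n)) : ℝ :=
  if G.Adj (Sum.inl e.1) (Sum.inr e.2) then 1 else 0

lemma ind_nonneg (e : Fin n × Fin n) (G : SimpleGraph (Fin n ⊕ Fin n)) : 0 ≤ ind e G := by
  unfold ind
  split_ifs <;> norm_num

lemma ind_mul_self (e : Fin n × Fin n) (G : SimpleGraph (Fin n ⊕ Fin n)) :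
    ind e G * ind e G = ind e G := by
  unfold ind
  split_ifs <;> norm_num

open Classical in
/-- The number of neighbours of `a` other than `b`. -/
noncomputable def leftCount (a b : Fin n) (G : SimpleGraph (Fin n ⊕ Fin n)) : ℕ :=
  {j ∈ Finset.univ.erase b | G.Adj (Sum.inl a) (Sum.inr j)}.card

open Classical in
/-- The number of neighbours of `b` other than `a`. -/
noncomputable def rightCount (a b : Fin n) (G : SimpleGraph (Fin n ⊕ Fin n)) : ℕ :=
  {i ∈ Finset.univ.erase a | G.Adj (Sum.inl i) (Sum.inr b)}.card

lemma leftCount_eq (a b : Fin n) (G : SimpleGraph (Fin n ⊕ Fin n)) :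
    (leftCount a b G : ℝ) = ∑ j ∈ Finset.univ.erase b, ind (a, j) G := by
  simp [leftCount, ind, Finset.sum_boole]

lemma rightCount_eq (a b : Fin n) (G : SimpleGraph (Fin n ⊕ Fin n)) :
    (rightCount a b G : ℝ) = ∑ i ∈ Finset.univ.erase a, ind (i, b) G := by
  simp [rightCount, ind, Finset.sum_boole]

variable {a b : Fin n} {G : SimpleGraph (Fin n ⊕ Fin n)}

lemma not_adj_inl_inl (hG : G ≤ completeBipartiteGraph (Fin n) (Fin n)) (i j : Fin n) :
    ¬ G.Adj (Sum.inl i) (Sum.inl j) := fun h => by simpa using hG h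

lemma not_adj_inr_inr (hG : G ≤ completeBipartiteGraph (Fin n) (Fin n)) (i j : Fin n) :
    ¬ G.Adj (Sum.inr i) (Sum.inr j) := fun h => by simpa using hG h

lemma ncard_neighborSet_inl (hG : G ≤ completeBipartiteGraph (Fin n) (Fin n))
    (h : G.Adj (Sum.inl a) (Sum.inr b)) :
    (G.neighborSet (Sum.inl a)).ncard = 1 + leftCount a b G := by
  classical
  have : G.neighborSet (Sum.inl a) = (((insert b {j ∈ Finset.univ.erase b |
      G.Adj (Sum.inl a) (Sum.inr j)}).map Function.Embedding.inr : Finset (Fin n ⊕ Fin n)) :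
        Set (Fin n ⊕ Fin n)) := by
    ext u
    rcases u with i | j
    · simpa using not_adj_inl_inl hG a i
    · by_cases hj : j = b
      · simp [hj, h]
      · simp [hj]
  rw [this, Set.ncard_coe_finset, Finset.card_map, Finset.card_insert_of_notMem (by simp),
    add_comm]
  rfl

lemma ncard_neighborSet_inr (hG : G ≤ completeBipartiteGraph (Fin n) (Fin n))
    (h : G.Adj (Sum.inl a) (Sum.inr b)) :
    (G.neighborSet (Sum.inr b)).ncard = 1 + rightCount a b G := by
  classical
  have : G.neighborSet (Sum.inr b) = (((insert a {i ∈ Finset.univ.erase a |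
      G.Adj (Sum.inl i) (Sum.inr b)}).map Function.Embedding.inl : Finset (Fin n ⊕ Fin n)) :
        Set (Fin n ⊕ Fin n)) := by
    ext u
    rcases u with i | j
    · by_cases hi : i = a
      · simp [hi, h.symm]
      · simp [hi, G.adj_comm]
    · simpa using not_adj_inr_inr hG b j
  rw [this, Set.ncard_coe_finset, Finset.card_map, Finset.card_insert_of_notMem (by simp),
    add_comm]
  rfl

/-- Neighbours of `a` are on the right side and neighbours of `b` on the left, so of the four blocks
of the double sum only one survives. -/
lemma crossEdges_eq (hG : G ≤ completeBipartiteGraph (Fin n) (Fin n)) :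
    crossEdges G (Sum.inl a) (Sum.inr b) = ∑ j ∈ Finset.univ.erase b, ∑ i ∈ Finset.univ.erase a,
      ind (a, j) G * (ind (i, b) G * ind (i, j) G) := by
  classical
  have h1 : ∀ u, ∀ j, ¬ (G.Adj (Sum.inl a) u ∧ G.Adj u (Sum.inr j) ∧
      G.Adj (Sum.inr b) (Sum.inr j)) :=
    fun u j h => not_adj_inr_inr hG _ _ h.2.2
  have h2 : ∀ i, ¬ G.Adj (Sum.inl a) (Sum.inl i) := not_adj_inl_inl hG a
  have key : ∀ i j, (if (Sum.inr j : Fin n ⊕ Fin n) ≠ Sum.inr b ∧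
      (Sum.inl i : Fin n ⊕ Fin n) ≠ Sum.inl a ∧
      G.Adj (Sum.inl a) (Sum.inr j) ∧ G.Adj (Sum.inr j) (Sum.inl i) ∧ G.Adj (Sum.inr b) (Sum.inl i)
        then (1 : ℝ) else 0) =
      if j ∈ Finset.univ.erase b then if i ∈ Finset.univ.erase a then
        ind (a, j) G * (ind (i, b) G * ind (i, j) G) else 0 else 0 := by
    intro i j
    rw [G.adj_comm (Sum.inr j), G.adj_comm (Sum.inr b)]
    by_cases e1 : j = b <;> by_cases e2 : i = a <;> by_cases e3 : G.Adj (Sum.inl a) (Sum.inr j) <;>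
      by_cases e4 : G.Adj (Sum.inl i) (Sum.inr j) <;>
      by_cases e5 : G.Adj (Sum.inl i) (Sum.inr b) <;> simp [ind, e1, e2, e3, e4, e5]
  simp only [crossEdges, Fintype.sum_sum_type, h1, h2, and_false, false_and, if_false,
    Finset.sum_const_zero, zero_add, add_zero]
  refine (Finset.sum_congr rfl fun j _ => Finset.sum_congr rfl fun i _ =>
    Eq.trans (by congr!) (key i j)).trans ?_
  rw [← Finset.univ_inter (Finset.univ.erase b), ← Finset.sum_ite_mem]
  refine Finset.sum_congr rfl fun j _ => ?_
  by_cases hj : j ∈ Finset.univ.erase b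
  · simp only [Finset.univ_inter, if_pos hj, Finset.sum_ite_mem]
  · simp only [Finset.univ_inter, if_neg hj, Finset.sum_const_zero]

/-- The marginal of the weight `X j * S j / (M * t)` is close to the uniform distribution. -/
lemma one_div_add_sum_abs_le {ι : Type*} (U : Finset ι) {X S : ι → ℝ} (hX : ∀ j, 0 ≤ X j)
    {M t : ℝ} (hM : 0 < M) (ht : 0 < t) :
    1 / (1 + ∑ j ∈ U, X j) + ∑ j ∈ U, |X j * S j / (M * t) - X j / (1 + ∑ j ∈ U, X j)| ≤
      (∑ j ∈ U, X j * |S j - t|) / (M * t) + 2 * |∑ j ∈ U, X j - M| / M + 3 / M := by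
  set N := ∑ j ∈ U, X j with hN
  have hN0 : 0 ≤ N := Finset.sum_nonneg fun j _ => hX j
  have hd : 0 < 1 + N := by linarith
  have hδ : |1 / M - 1 / (1 + N)| = |1 + N - M| / (M * (1 + N)) := by
    rw [div_sub_div _ _ hM.ne' hd.ne', abs_div, abs_of_pos (mul_pos hM hd)]
    ring_nf
  have hle : |1 + N - M| ≤ |N - M| + 1 := by
    rw [add_sub_assoc, add_comm]
    simpa using abs_add_le (N - M) 1
  have h1 : (1 + N) * |1 / M - 1 / (1 + N)| ≤ (|N - M| + 1) / M := by
    rw [hδ]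
    calc (1 + N) * (|1 + N - M| / (M * (1 + N))) = |1 + N - M| / M := by field_simp
      _ ≤ _ := by gcongr
  have h1' : |1 / M - 1 / (1 + N)| ≤ (|N - M| + 1) / M := by
    refine le_trans ?_ h1
    nlinarith [abs_nonneg (1 / M - 1 / (1 + N))]
  have h2 : 1 / (1 + N) ≤ 1 / M + (|N - M| + 1) / M := by
    linarith [neg_abs_le (1 / M - 1 / (1 + N))]
  have h3 : ∑ j ∈ U, |X j * S j / (M * t) - X j / (1 + N)| ≤
      (∑ j ∈ U, X j * |S j - t|) / (M * t) + N * |1 / M - 1 / (1 + N)| := by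
    rw [Finset.sum_div, hN, Finset.sum_mul, ← Finset.sum_add_distrib, ← hN]
    refine Finset.sum_le_sum fun j _ => ?_
    -- The two sources of error are separated: `S j` deviating from `t`, and the degree 1 + N
    -- deviating from `M`.
    have : X j * S j / (M * t) - X j / (1 + N) =
        X j * ((S j - t) / (M * t)) + X j * (1 / M - 1 / (1 + N)) := by
      field_simp
      ring
    rw [this]
    refine (abs_add_le _ _).trans ?_
    rw [abs_mul, abs_mul, abs_of_nonneg (hX j), abs_div, abs_of_pos (mul_pos hM ht), mul_div_assoc]
  have h4 : N * |1 / M - 1 / (1 + N)| ≤ (|N - M| + 1) / M := by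
    refine le_trans ?_ h1
    nlinarith [abs_nonneg (1 / M - 1 / (1 + N))]
  calc _ ≤ 1 / M + (|N - M| + 1) / M +
        ((∑ j ∈ U, X j * |S j - t|) / (M * t) + (|N - M| + 1) / M) := by linarith
    _ = _ := by ring

lemma one_div_one_add_le {N M : ℝ} (hN : 0 ≤ N) (hM : 0 < M) :
    1 / (1 + N) ≤ 2 * |N - M| / M + 3 / M := by
  have := one_div_add_sum_abs_le (U := {()}) (X := fun _ => N) (S := fun _ => 1)
    (fun _ => hN) hM one_pos
  simp only [Finset.sum_singleton, sub_self, abs_zero, mul_zero, zero_div, zero_add] at this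
  linarith [abs_nonneg (N * 1 / (M * 1) - N / (1 + N))]

/-- The deviation of the number of paths of length two from `b` to the neighbours of `a`. -/
noncomputable def leftError (a b : Fin n) (t : ℝ) (G : SimpleGraph (Fin n ⊕ Fin n)) : ℝ :=
  ∑ j ∈ Finset.univ.erase b, ind (a, j) G *
    |∑ i ∈ Finset.univ.erase a, ind (i, b) G * ind (i, j) G - t|

/-- The deviation of the number of paths of length two from `a` to the neighbours of `b`. -/
noncomputable def rightError (a b : Fin n) (t : ℝ) (G : SimpleGraph (Fin n ⊕ Fin n)) : ℝ :=
  ∑ i ∈ Finset.univ.erase a, ind (i, b) G *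
    |∑ j ∈ Finset.univ.erase b, ind (a, j) G * ind (i, j) G - t|

lemma walk_inl_inr (hG : G ≤ completeBipartiteGraph (Fin n) (Fin n))
    (h : G.Adj (Sum.inl a) (Sum.inr b)) (j : Fin n) :
    walk G (Sum.inl a) (Sum.inr j) = ind (a, j) G / (1 + leftCount a b G) := by
  by_cases hj : G.Adj (Sum.inl a) (Sum.inr j)
  · simp [walk_of_adj hj, ncard_neighborSet_inl hG h, ind, hj]
  · simp [walk_of_not_adj hj, ind, hj]

lemma walk_inr_inl (hG : G ≤ completeBipartiteGraph (Fin n) (Fin n))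
    (h : G.Adj (Sum.inl a) (Sum.inr b)) (i : Fin n) :
    walk G (Sum.inr b) (Sum.inl i) = ind (i, b) G / (1 + rightCount a b G) := by
  by_cases hi : G.Adj (Sum.inr b) (Sum.inl i)
  · simp [walk_of_adj hi, ncard_neighborSet_inr hG h, ind, hi.symm]
  · simp [walk_of_not_adj hi, ind, mt (fun h' => G.adj_symm h') hi]

lemma le_ricci_of_error (hG : G ≤ completeBipartiteGraph (Fin n) (Fin n))
    (h : G.Adj (Sum.inl a) (Sum.inr b)) {M t : ℝ} (hM : 0 < M) (ht : 0 < t) :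
    -2 * ((leftError a b t G + rightError a b t G) / (M * t) +
      2 * (|(leftCount a b G : ℝ) - M| + |(rightCount a b G : ℝ) - M|) / M + 6 / M) ≤
      ricci G (Sum.inl a) (Sum.inr b) := by
  classical
  have hab : ind (a, b) G = 1 := by simp [ind, h]
  -- Equal weight 1/(Mt) on every cross edge. In the application M = (n-1)p and t = (n-1)p², so Mt
  -- is the expected number of cross edges.
  set ξ : Fin n ⊕ Fin n → Fin n ⊕ Fin n → ℝ := fun u v => Sum.elim (fun _ => 0) (fun j =>
    Sum.elim (fun i => if j = b then 0 else if i = a then 0 else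
      ind (a, j) G * (ind (i, b) G * ind (i, j) G) / (M * t)) (fun _ => 0) v) u with hξ
  have key := le_ricci_of_weight (ξ := ξ) (sideColoring hG) h
    (by
      rintro (u | u) (v | v) <;> simp only [hξ, Sum.elim_inl, Sum.elim_inr, le_refl]
      have := ind_nonneg (a, u) G
      have := ind_nonneg (v, b) G
      have := ind_nonneg (v, u) G
      split_ifs <;> positivity)
    (by
      rintro (u | u) (v | v) huv <;> simp only [hξ, Sum.elim_inl, Sum.elim_inr]
      have : ind (v, u) G = 0 := by
        simp only [ind]
        rw [if_neg fun h' => huv (G.adj_symm h')]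
      simp [this])
  have hrow : ∀ j, ∑ v, ξ (Sum.inr j) v = if j = b then 0 else
      ind (a, j) G * (∑ i ∈ Finset.univ.erase a, ind (i, b) G * ind (i, j) G) / (M * t) := by
    intro j
    simp only [hξ, Fintype.sum_sum_type, Sum.elim_inl, Sum.elim_inr, Finset.sum_const_zero,
      add_zero]
    split_ifs with hj
    · simp
    · rw [← Finset.add_sum_erase _ _ (Finset.mem_univ a), if_pos rfl, zero_add, Finset.mul_sum,
        Finset.sum_div]
      exact Finset.sum_congr rfl fun i hi => if_neg (Finset.ne_of_mem_erase hi)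
  have hcol : ∀ i, ∑ u, ξ u (Sum.inl i) = if i = a then 0 else
      ind (i, b) G * (∑ j ∈ Finset.univ.erase b, ind (a, j) G * ind (i, j) G) / (M * t) := by
    intro i
    simp only [hξ, Fintype.sum_sum_type, Sum.elim_inl, Sum.elim_inr, Finset.sum_const_zero,
      zero_add]
    split_ifs with hi
    · simp
    · rw [← Finset.add_sum_erase _ _ (Finset.mem_univ b), if_pos rfl, zero_add, Finset.mul_sum,
        Finset.sum_div]
      refine Finset.sum_congr rfl fun j hj => ?_
      rw [if_neg (Finset.ne_of_mem_erase hj)]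
      ring
  have hrow' : ∑ u, |∑ v, ξ u v - walk G (Sum.inl a) u| ≤
      leftError a b t G / (M * t) + 2 * |(leftCount a b G : ℝ) - M| / M + 3 / M := by
    have := one_div_add_sum_abs_le (Finset.univ.erase b) (X := fun j => ind (a, j) G)
      (S := fun j => ∑ i ∈ Finset.univ.erase a, ind (i, b) G * ind (i, j) G)
      (fun j => ind_nonneg _ _) hM ht
    rw [← leftCount_eq] at this
    refine le_trans (le_of_eq ?_) this
    have h0 : ∀ i, |∑ v, ξ (Sum.inl i) v - walk G (Sum.inl a) (Sum.inl i)| = 0 := fun i => by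
      simp [hξ, walk_of_not_adj (not_adj_inl_inl hG a i)]
    rw [Fintype.sum_sum_type]
    simp only [h0, Finset.sum_const_zero, zero_add, hrow, walk_inl_inr hG h]
    -- The row of `b` carries no weight, so its error is the full walk mass 1/(1 + N), the isolated
    -- first term of `one_div_add_sum_abs_le`.
    rw [← Finset.add_sum_erase _ _ (Finset.mem_univ b)]
    congr 1
    · rw [if_pos rfl, zero_sub, abs_neg, hab, abs_of_nonneg (by positivity)]
    · exact Finset.sum_congr rfl fun j hj => by rw [if_neg (Finset.ne_of_mem_erase hj)]
  have hcol' : ∑ v, |∑ u, ξ u v - walk G (Sum.inr b) v| ≤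
      rightError a b t G / (M * t) + 2 * |(rightCount a b G : ℝ) - M| / M + 3 / M := by
    have := one_div_add_sum_abs_le (Finset.univ.erase a) (X := fun i => ind (i, b) G)
      (S := fun i => ∑ j ∈ Finset.univ.erase b, ind (a, j) G * ind (i, j) G)
      (fun j => ind_nonneg _ _) hM ht
    rw [← rightCount_eq] at this
    refine le_trans (le_of_eq ?_) this
    have h0 : ∀ j, |∑ u, ξ u (Sum.inr j) - walk G (Sum.inr b) (Sum.inr j)| = 0 := fun j => by
      simp [hξ, walk_of_not_adj (not_adj_inr_inr hG b j)]
    rw [Fintype.sum_sum_type]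
    simp only [h0, Finset.sum_const_zero, add_zero, hcol, walk_inr_inl hG h]
    rw [← Finset.add_sum_erase _ _ (Finset.mem_univ a)]
    congr 1
    · rw [if_pos rfl, zero_sub, abs_neg, hab, abs_of_nonneg (by positivity)]
    · exact Finset.sum_congr rfl fun j hj => by rw [if_neg (Finset.ne_of_mem_erase hj)]
  refine le_trans ?_ key
  have : (leftError a b t G + rightError a b t G) / (M * t) +
      2 * (|(leftCount a b G : ℝ) - M| + |(rightCount a b G : ℝ) - M|) / M + 6 / M =
      (leftError a b t G / (M * t) + 2 * |(leftCount a b G : ℝ) - M| / M + 3 / M) +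
      (rightError a b t G / (M * t) + 2 * |(rightCount a b G : ℝ) - M| / M + 3 / M) := by
    ring
  linarith

lemma crossEdges_nonneg {V : Type*} [Fintype V] (G : SimpleGraph V) (x y : V) :
    0 ≤ crossEdges G x y :=
  Finset.sum_nonneg fun u _ => Finset.sum_nonneg fun v _ => by split_ifs <;> norm_num

lemma ricci_le_of_error (hG : G ≤ completeBipartiteGraph (Fin n) (Fin n))
    (h : G.Adj (Sum.inl a) (Sum.inr b)) {M : ℝ} (hM : 0 < M) :
    ricci G (Sum.inl a) (Sum.inr b) + 2 ≤
      (8 * (|(leftCount a b G : ℝ) - M| + |(rightCount a b G : ℝ) - M|) + 12) / M +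
        4 * crossEdges G (Sum.inl a) (Sum.inr b) / M := by
  have h1 := ricci_le_crossEdges (sideColoring hG) h
  have h2 := ricci_nonpos (sideColoring hG) h
  rw [ncard_neighborSet_inl hG h, ncard_neighborSet_inr hG h] at h1
  push_cast at h1
  set N := (leftCount a b G : ℝ)
  set N' := (rightCount a b G : ℝ)
  have hN : 0 ≤ N := Nat.cast_nonneg _
  have hN' : 0 ≤ N' := Nat.cast_nonneg _
  set T := crossEdges G (Sum.inl a) (Sum.inr b)
  have hT : 0 ≤ T := crossEdges_nonneg ..
  have h3 := one_div_one_add_le hN hM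
  have h4 := one_div_one_add_le hN' hM
  have hA := abs_nonneg (N - M)
  have hA' := abs_nonneg (N' - M)
  -- Either the degree of `a` is at least M/2, and T/(1 + N) ≤ 2T/M, or |N - M| > M/2 and the right
  -- side already exceeds the trivial bound 2.
  rcases le_or_gt (M / 2) (1 + N) with hc | hc
  · have h5 : T / (1 + N) ≤ 2 * T / M := by
      rw [div_le_div_iff₀ (by linarith) hM]
      nlinarith
    have : (8 * (|N - M| + |N' - M|) + 12) / M + 4 * T / M =
        2 * (2 * |N - M| / M + 3 / M) + 2 * (2 * |N' - M| / M + 3 / M) + 2 * (2 * T / M) +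
        4 * (|N - M| + |N' - M|) / M := by
      ring
    have : 0 ≤ 4 * (|N - M| + |N' - M|) / M := by positivity
    linarith
  · have h5 : M / 2 ≤ |N - M| := by linarith [neg_abs_le (N - M)]
    have h6 : 2 ≤ (8 * (|N - M| + |N' - M|) + 12) / M := by
      rw [le_div_iff₀ hM]
      linarith
    have : 0 ≤ 4 * T / M := by positivity
    linarith

lemma ricci_eq_of_crossEdges_eq_zero (hG : G ≤ completeBipartiteGraph (Fin n) (Fin n))
    (h : G.Adj (Sum.inl a) (Sum.inr b)) (h0 : crossEdges G (Sum.inl a) (Sum.inr b) = 0) :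
    ricci G (Sum.inl a) (Sum.inr b) =
      -2 * max (1 - 1 / (1 + (leftCount a b G : ℝ)) - 1 / (1 + (rightCount a b G : ℝ))) 0 := by
  have h1 := ricci_le_crossEdges (sideColoring hG) h
  have h2 := ricci_nonpos (sideColoring hG) h
  have h3 := neg_two_mul_max_le_ricci (sideColoring hG) h
  rw [ncard_neighborSet_inl hG h, ncard_neighborSet_inr hG h] at h1 h3
  push_cast at h1 h3
  rw [h0, zero_div] at h1
  refine le_antisymm ?_ h3
  rcases max_cases (1 - 1 / (1 + (leftCount a b G : ℝ)) - 1 / (1 + (rightCount a b G : ℝ))) 0 with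
    hm | hm <;> rw [hm.1] <;> linarith

end Counts

/-! ### First and second moment estimates -/

section Moments

/-- Second moment of a weighted sum of pairwise uncorrelated indicators. -/
lemma integral_mul_sq_sub_le {Ω ι : Type*} [MeasurableSpace Ω] [Finite Ω]
    [DiscreteMeasurableSpace Ω] {μ : Measure Ω} [IsFiniteMeasure μ] (S : Finset ι)
    {ξ : ι → Ω → ℝ} {w : Ω → ℝ} {q : ℝ} (hw : ∀ ω, 0 ≤ w ω)
    (hξ : ∀ s ω, ξ s ω * ξ s ω = ξ s ω)
    (h1 : ∀ s ∈ S, ∫ ω, w ω * ξ s ω ∂μ = q * ∫ ω, w ω ∂μ)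
    (h2 : ∀ s ∈ S, ∀ t ∈ S, s ≠ t → ∫ ω, w ω * (ξ s ω * ξ t ω) ∂μ = q ^ 2 * ∫ ω, w ω ∂μ) :
    ∫ ω, w ω * (∑ s ∈ S, ξ s ω - S.card * q) ^ 2 ∂μ ≤ S.card * q * ∫ ω, w ω ∂μ := by
  classical
  set W := ∫ ω, w ω ∂μ
  have hW : 0 ≤ W := integral_nonneg hw
  have e1 : ∀ ω, w ω * (∑ s ∈ S, ξ s ω - S.card * q) ^ 2 =
      (∑ s ∈ S, ∑ t ∈ S, w ω * (ξ s ω * ξ t ω)) - 2 * (S.card * q) * ∑ s ∈ S, w ω * ξ s ω +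
        (S.card * q) ^ 2 * w ω := by
    intro ω
    simp_rw [← Finset.mul_sum]
    rw [← Finset.sum_mul]
    ring
  simp_rw [e1]
  rw [integral_add .of_finite .of_finite, integral_sub .of_finite .of_finite,
    integral_const_mul, integral_const_mul, integral_finsetSum _ fun _ _ => .of_finite,
    integral_finsetSum _ fun _ _ => .of_finite, Finset.sum_congr rfl h1]
  -- Each row has q²W from every t, and the diagonal adds (q - q²)W since an indicator is its own
  -- square.
  have e2 : ∑ s ∈ S, ∫ ω, ∑ t ∈ S, w ω * (ξ s ω * ξ t ω) ∂μ =
      ∑ s ∈ S, (S.card * q ^ 2 + (q - q ^ 2)) * W := by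
    refine Finset.sum_congr rfl fun s hs => ?_
    rw [integral_finsetSum _ fun _ _ => .of_finite]
    have : ∀ t ∈ S, ∫ ω, w ω * (ξ s ω * ξ t ω) ∂μ =
        q ^ 2 * W + if s = t then (q - q ^ 2) * W else 0 := by
      intro t ht
      split_ifs with hst
      · subst hst
        simp_rw [hξ]
        rw [h1 s hs]
        ring
      · rw [h2 s hs t ht hst, add_zero]
    rw [Finset.sum_congr rfl this, Finset.sum_add_distrib, Finset.sum_ite_eq, if_pos hs,
      Finset.sum_const, nsmul_eq_mul]
    ring
  rw [e2, Finset.sum_const, Finset.sum_const, nsmul_eq_mul, nsmul_eq_mul]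
  have : 0 ≤ (S.card : ℝ) * q ^ 2 * W := by positivity
  linear_combination this

lemma le_sq_div_add {v : ℝ} (hv : 0 < v) (x : ℝ) : x ≤ 1 / (2 * v) * x ^ 2 + v / 2 := by
  have : 1 / (2 * v) * x ^ 2 + v / 2 - x = (x - v) ^ 2 / (2 * v) := by
    field_simp
    ring
  have : 0 ≤ (x - v) ^ 2 / (2 * v) := by positivity
  linarith

lemma half_add_half_mul {v : ℝ} (hv : 0 < v) (W : ℝ) :
    1 / (2 * v) * (v * v * W) + v / 2 * W = v * W := by
  field_simp
  ring

/-- The first absolute moment is obtained from the second through x ≤ x²/(2v) + v/2, with v the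
bound √(|S|q) on the standard deviation, in place of Cauchy-Schwarz. The weight `w` will be the
indicator that a given vertex is a neighbour of `a` or of `b`. -/
lemma integral_mul_abs_sub_le {Ω ι : Type*} [MeasurableSpace Ω] [Finite Ω]
    [DiscreteMeasurableSpace Ω] {μ : Measure Ω} [IsFiniteMeasure μ] (S : Finset ι)
    {ξ : ι → Ω → ℝ} {w : Ω → ℝ} {q : ℝ} (hw : ∀ ω, 0 ≤ w ω)
    (hξ : ∀ s ω, ξ s ω * ξ s ω = ξ s ω)
    (h1 : ∀ s ∈ S, ∫ ω, w ω * ξ s ω ∂μ = q * ∫ ω, w ω ∂μ)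
    (h2 : ∀ s ∈ S, ∀ t ∈ S, s ≠ t → ∫ ω, w ω * (ξ s ω * ξ t ω) ∂μ = q ^ 2 * ∫ ω, w ω ∂μ)
    (hq : 0 < S.card * q) :
    ∫ ω, w ω * |∑ s ∈ S, ξ s ω - S.card * q| ∂μ ≤ √(S.card * q) * ∫ ω, w ω ∂μ := by
  have h3 := integral_mul_sq_sub_le S hw hξ h1 h2
  set W := ∫ ω, w ω ∂μ
  set v := √(S.card * q) with hv
  have hv0 : 0 < v := Real.sqrt_pos.2 hq
  have hvv : S.card * q = v * v := (Real.mul_self_sqrt hq.le).symm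
  calc ∫ ω, w ω * |∑ s ∈ S, ξ s ω - S.card * q| ∂μ
      ≤ ∫ ω, (1 / (2 * v)) * (w ω * (∑ s ∈ S, ξ s ω - S.card * q) ^ 2) + v / 2 * w ω ∂μ := by
        refine integral_mono .of_finite .of_finite fun ω => ?_
        have : |∑ s ∈ S, ξ s ω - S.card * q| ≤
            (1 / (2 * v)) * (∑ s ∈ S, ξ s ω - S.card * q) ^ 2 + v / 2 := by
          rw [← sq_abs (∑ s ∈ S, ξ s ω - S.card * q)]
          exact le_sq_div_add hv0 _
        have := mul_le_mul_of_nonneg_left this (hw ω)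
        linear_combination this
    _ ≤ (1 / (2 * v)) * (v * v * W) + v / 2 * W := by
        rw [integral_add .of_finite .of_finite, integral_const_mul, integral_const_mul]
        exact add_le_add_left (mul_le_mul_of_nonneg_left (h3.trans_eq (by rw [hvv]))
          (one_div_nonneg.2 (mul_nonneg two_pos.le hv0.le))) _
    _ = v * W := half_add_half_mul hv0 W

variable {n : ℕ} {a b : Fin n} {p : Set.Ioc (0 : ℝ) 1}

lemma integral_prod_ind (l : List (Fin n × Fin n)) (hl : l.Nodup) (hab : (a, b) ∉ l) :
    ∫ G, (l.map fun e => ind e G).prod ∂(condLaw n a b p) = (p : ℝ) ^ l.length := by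
  classical
  have h := condLaw_boxEvent (p := p) (F := l.toFinset) (F' := ∅) (a := a) (b := b) (by simp)
    (by simpa using hab) (by simp)
  rw [List.toFinset_card_of_nodup hl, Finset.card_empty, pow_zero, mul_one] at h
  rw [← h, ← integral_indicator_one .of_discrete]
  congr 1
  ext G
  rw [← List.prod_toFinset _ hl]
  by_cases hG : G ∈ boxEvent (Fin n) (Fin n) l.toFinset ∅
  · rw [Set.indicator_of_mem hG]
    exact Finset.prod_eq_one fun e he => if_pos (hG.1 e he)
  · rw [Set.indicator_of_notMem hG]
    have : ∃ e ∈ l.toFinset, ¬ G.Adj (Sum.inl e.1) (Sum.inr e.2) := by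
      by_contra! hc
      exact hG ⟨hc, by simp⟩
    obtain ⟨e, he, he'⟩ := this
    exact Finset.prod_eq_zero he (if_neg he')

lemma integral_ind {e : Fin n × Fin n} (he : e ≠ (a, b)) :
    ∫ G, ind e G ∂(condLaw n a b p) = p := by
  simpa using integral_prod_ind (p := p) [e] (by simp) (by simpa using he.symm)

lemma card_univ_erase (b : Fin n) : ((Finset.univ.erase b).card : ℝ) = (n - 1 : ℕ) := by
  simp

lemma integral_abs_leftCount_sub_le (hM : 0 < ((n - 1 : ℕ) : ℝ) * p) :
    ∫ G, |(leftCount a b G : ℝ) - (n - 1 : ℕ) * p| ∂(condLaw n a b p) ≤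
      √((n - 1 : ℕ) * p) := by
  have := integral_mul_abs_sub_le (μ := condLaw n a b p) (Finset.univ.erase b)
    (ξ := fun j => ind (a, j)) (w := 1) (q := p) (by simp) (fun s G => ind_mul_self _ _)
    (fun j hj => by
      simpa using integral_ind (p := p) (a := a) (b := b) (e := (a, j))
        (by simpa using hj))
    (fun j hj k hk hjk => by
      simpa using integral_prod_ind (p := p) (a := a) (b := b) [(a, j), (a, k)]
        (by simpa using hjk) (by simpa [eq_comm] using And.intro hj hk))
    (by rwa [card_univ_erase])
  rw [card_univ_erase] at this
  simpa [leftCount_eq] using this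

lemma integral_abs_rightCount_sub_le (hM : 0 < ((n - 1 : ℕ) : ℝ) * p) :
    ∫ G, |(rightCount a b G : ℝ) - (n - 1 : ℕ) * p| ∂(condLaw n a b p) ≤
      √((n - 1 : ℕ) * p) := by
  have := integral_mul_abs_sub_le (μ := condLaw n a b p) (Finset.univ.erase a)
    (ξ := fun i => ind (i, b)) (w := 1) (q := p) (by simp) (fun s G => ind_mul_self _ _)
    (fun j hj => by
      simpa using integral_ind (p := p) (a := a) (b := b) (e := (j, b))
        (by simpa using hj))
    (fun j hj k hk hjk => by
      simpa using integral_prod_ind (p := p) (a := a) (b := b) [(j, b), (k, b)]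
        (by simpa using hjk) (by simpa [eq_comm] using And.intro hj hk))
    (by rwa [card_univ_erase])
  rw [card_univ_erase] at this
  simpa [rightCount_eq] using this

lemma integral_leftError_le (hM : 0 < ((n - 1 : ℕ) : ℝ) * (p : ℝ) ^ 2) :
    ∫ G, leftError a b ((n - 1 : ℕ) * (p : ℝ) ^ 2) G ∂(condLaw n a b p) ≤
      ((n - 1 : ℕ) : ℝ) * p * √((n - 1 : ℕ) * (p : ℝ) ^ 2) := by
  unfold leftError
  rw [integral_finsetSum _ fun _ _ => .of_finite]
  have key : ∀ j ∈ Finset.univ.erase b, ∫ G, ind (a, j) G *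
      |∑ i ∈ Finset.univ.erase a, ind (i, b) G * ind (i, j) G - (n - 1 : ℕ) * (p : ℝ) ^ 2|
        ∂(condLaw n a b p) ≤ √((n - 1 : ℕ) * (p : ℝ) ^ 2) * p := by
    intro j hj
    have hj' : j ≠ b := Finset.ne_of_mem_erase hj
    have e := integral_ind (p := p) (a := a) (b := b) (e := (a, j)) (by simpa using hj')
    -- For fixed `j`, the paths b, i, j with different `i` share no edge, and none uses (a, j) or
    -- (a, b); each is present with probability p².
    have := integral_mul_abs_sub_le (μ := condLaw n a b p) (Finset.univ.erase a)
      (ξ := fun i G => ind (i, b) G * ind (i, j) G) (w := ind (a, j)) (q := (p : ℝ) ^ 2)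
      (ind_nonneg _)
      (fun s G => by rw [mul_mul_mul_comm, ind_mul_self, ind_mul_self])
      (fun i hi => by
        have hi' : i ≠ a := Finset.ne_of_mem_erase hi
        have := integral_prod_ind (p := p) (a := a) (b := b) [(a, j), (i, b), (i, j)]
          (by simp [*, hj'.symm, hi'.symm]) (by simp [*, hj'.symm, hi'.symm])
        simp only [List.map_cons, List.map_nil, List.prod_cons, List.prod_nil, mul_one,
          List.length_cons, List.length_nil] at this
        rw [this, e]
        ring)
      (fun i hi k hk hik => by
        have hi' : i ≠ a := Finset.ne_of_mem_erase hi
        have hk' : k ≠ a := Finset.ne_of_mem_erase hk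
        have := integral_prod_ind (p := p) (a := a) (b := b)
          [(a, j), (i, b), (i, j), (k, b), (k, j)]
          (by simp [*, hj'.symm, hi'.symm, hk'.symm])
          (by simp [*, hj'.symm, hi'.symm, hk'.symm])
        simp only [List.map_cons, List.map_nil, List.prod_cons, List.prod_nil, mul_one,
          List.length_cons, List.length_nil] at this
        simp only [mul_assoc]
        rw [this, e]
        ring)
      (by rwa [card_univ_erase])
    rw [card_univ_erase, e] at this
    exact this
  refine (Finset.sum_le_sum key).trans (le_of_eq ?_)
  rw [Finset.sum_const, nsmul_eq_mul, card_univ_erase]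
  ring

lemma integral_rightError_le (hM : 0 < ((n - 1 : ℕ) : ℝ) * (p : ℝ) ^ 2) :
    ∫ G, rightError a b ((n - 1 : ℕ) * (p : ℝ) ^ 2) G ∂(condLaw n a b p) ≤
      ((n - 1 : ℕ) : ℝ) * p * √((n - 1 : ℕ) * (p : ℝ) ^ 2) := by
  unfold rightError
  rw [integral_finsetSum _ fun _ _ => .of_finite]
  have key : ∀ i ∈ Finset.univ.erase a, ∫ G, ind (i, b) G *
      |∑ j ∈ Finset.univ.erase b, ind (a, j) G * ind (i, j) G - (n - 1 : ℕ) * (p : ℝ) ^ 2|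
        ∂(condLaw n a b p) ≤ √((n - 1 : ℕ) * (p : ℝ) ^ 2) * p := by
    intro i hi
    have hi' : i ≠ a := Finset.ne_of_mem_erase hi
    have e := integral_ind (p := p) (a := a) (b := b) (e := (i, b)) (by simpa using hi')
    have := integral_mul_abs_sub_le (μ := condLaw n a b p) (Finset.univ.erase b)
      (ξ := fun j G => ind (a, j) G * ind (i, j) G) (w := ind (i, b)) (q := (p : ℝ) ^ 2)
      (ind_nonneg _)
      (fun s G => by rw [mul_mul_mul_comm, ind_mul_self, ind_mul_self])
      (fun j hj => by
        have hj' : j ≠ b := Finset.ne_of_mem_erase hj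
        have := integral_prod_ind (p := p) (a := a) (b := b) [(i, b), (a, j), (i, j)]
          (by simp [*, hj'.symm, hi'.symm]) (by simp [*, hj'.symm, hi'.symm])
        simp only [List.map_cons, List.map_nil, List.prod_cons, List.prod_nil, mul_one,
          List.length_cons, List.length_nil] at this
        rw [this, e]
        ring)
      (fun j hj k hk hjk => by
        have hj' : j ≠ b := Finset.ne_of_mem_erase hj
        have hk' : k ≠ b := Finset.ne_of_mem_erase hk
        have := integral_prod_ind (p := p) (a := a) (b := b)
          [(i, b), (a, j), (i, j), (a, k), (i, k)]
          (by simp [*, hj'.symm, hi'.symm, hk'.symm])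
          (by simp [*, hj'.symm, hi'.symm, hk'.symm])
        simp only [List.map_cons, List.map_nil, List.prod_cons, List.prod_nil, mul_one,
          List.length_cons, List.length_nil] at this
        simp only [mul_assoc]
        rw [this, e]
        ring)
      (by rwa [card_univ_erase])
    rw [card_univ_erase, e] at this
    exact this
  refine (Finset.sum_le_sum key).trans (le_of_eq ?_)
  rw [Finset.sum_const, nsmul_eq_mul, card_univ_erase]
  ring

lemma integral_crossEdges :
    ∫ G, crossEdges G (Sum.inl a) (Sum.inr b) ∂(condLaw n a b p) =
      ((n - 1 : ℕ) : ℝ) ^ 2 * (p : ℝ) ^ 3 := by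
  have h : (fun G => crossEdges G (Sum.inl a) (Sum.inr b)) =ᵐ[condLaw n a b p] fun G =>
      ∑ j ∈ Finset.univ.erase b, ∑ i ∈ Finset.univ.erase a,
        ind (a, j) G * (ind (i, b) G * ind (i, j) G) :=
    condLaw_ae.mono fun G hG => crossEdges_eq hG.2
  rw [integral_congr_ae h, integral_finsetSum _ fun _ _ => .of_finite]
  have key : ∀ j ∈ Finset.univ.erase b, ∫ G, ∑ i ∈ Finset.univ.erase a,
      ind (a, j) G * (ind (i, b) G * ind (i, j) G) ∂(condLaw n a b p) =
        ((n - 1 : ℕ) : ℝ) * (p : ℝ) ^ 3 := by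
    intro j hj
    have hj' : j ≠ b := Finset.ne_of_mem_erase hj
    rw [integral_finsetSum _ fun _ _ => .of_finite]
    have : ∀ i ∈ Finset.univ.erase a,
        ∫ G, ind (a, j) G * (ind (i, b) G * ind (i, j) G) ∂(condLaw n a b p) = (p : ℝ) ^ 3 := by
      intro i hi
      have hi' : i ≠ a := Finset.ne_of_mem_erase hi
      simpa using integral_prod_ind (p := p) (a := a) (b := b) [(a, j), (i, b), (i, j)]
        (by simp [*, hj'.symm, hi'.symm]) (by simp [*, hj'.symm, hi'.symm])
    rw [Finset.sum_congr rfl this, Finset.sum_const, nsmul_eq_mul, card_univ_erase]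
  rw [Finset.sum_congr rfl key, Finset.sum_const, nsmul_eq_mul, card_univ_erase]
  ring

lemma integral_abs_ricci_le (hM : 0 < ((n - 1 : ℕ) : ℝ) * (p : ℝ) ^ 2) :
    ∫ G, |ricci G (Sum.inl a) (Sum.inr b)| ∂(condLaw n a b p) ≤
      4 / √((n - 1 : ℕ) * (p : ℝ) ^ 2) + 8 / √((n - 1 : ℕ) * (p : ℝ)) +
        12 / ((n - 1 : ℕ) * (p : ℝ)) := by
  have hp : (0 : ℝ) < p := p.2.1
  set t := ((n - 1 : ℕ) : ℝ) * (p : ℝ) ^ 2 with ht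
  set M := ((n - 1 : ℕ) : ℝ) * (p : ℝ) with hM'
  have hM0 : 0 < M := by
    by_contra! hc
    have : t = M * p := by rw [ht, hM']; ring
    nlinarith
  -- The expected path errors are at most M√t each and the expected degree errors at most √M, so
  -- after division by Mt and M they are of order 1/√t and 1/√M.
  have hb : ∀ᵐ G ∂(condLaw n a b p), |ricci G (Sum.inl a) (Sum.inr b)| ≤
      2 / (M * t) * leftError a b t G + 2 / (M * t) * rightError a b t G +
      4 / M * |(leftCount a b G : ℝ) - M| + 4 / M * |(rightCount a b G : ℝ) - M| + 12 / M := by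
    filter_upwards [condLaw_ae] with G hG
    rw [abs_of_nonpos (ricci_nonpos (sideColoring hG.2) hG.1)]
    have := le_ricci_of_error hG.2 hG.1 hM0 hM
    linear_combination this
  have h1 := integral_leftError_le (a := a) (b := b) hM
  have h2 := integral_rightError_le (a := a) (b := b) hM
  have h3 := integral_abs_leftCount_sub_le (a := a) (b := b) hM0
  have h4 := integral_abs_rightCount_sub_le (a := a) (b := b) hM0
  rw [← ht, ← hM'] at h1 h2
  rw [← hM'] at h3 h4
  refine (integral_mono_ae .of_finite .of_finite hb).trans ?_
  rw [integral_add .of_finite .of_finite, integral_add .of_finite .of_finite,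
    integral_add .of_finite .of_finite, integral_add .of_finite .of_finite,
    integral_const_mul, integral_const_mul, integral_const_mul, integral_const_mul,
    integral_const, probReal_univ, one_smul]
  have et : √t * √t = t := Real.mul_self_sqrt hM.le
  have eM : √M * √M = M := Real.mul_self_sqrt hM0.le
  have st : 0 < √t := Real.sqrt_pos.2 hM
  have sM : 0 < √M := Real.sqrt_pos.2 hM0
  calc _ ≤ 2 / (M * t) * (M * √t) + 2 / (M * t) * (M * √t) + 4 / M * √M + 4 / M * √M + 12 / M := by
        gcongr
    _ = _ := by
        have e1 : 2 / (M * t) * (M * √t) = 2 / √t := by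
          rw [← et]
          field_simp
          rw [Real.sqrt_sq st.le]
        have e2 : 4 / M * √M = 4 / √M := by
          nth_rewrite 1 [← eM]
          field_simp
        rw [e1, e2]
        ring

lemma integral_abs_ricci_add_two_le (hM : 0 < ((n - 1 : ℕ) : ℝ) * (p : ℝ)) :
    ∫ G, |ricci G (Sum.inl a) (Sum.inr b) - -2| ∂(condLaw n a b p) ≤
      16 / √((n - 1 : ℕ) * (p : ℝ)) + 12 / ((n - 1 : ℕ) * (p : ℝ)) +
        4 * ((n - 1 : ℕ) * (p : ℝ) ^ 2) := by
  have hp : (0 : ℝ) < p := p.2.1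
  set M := ((n - 1 : ℕ) : ℝ) * (p : ℝ) with hM'
  have h5 : ∫ G, crossEdges G (Sum.inl a) (Sum.inr b) ∂(condLaw n a b p) =
      M * (((n - 1 : ℕ) : ℝ) * (p : ℝ) ^ 2) := integral_crossEdges.trans (by rw [hM']; ring)
  have hb : ∀ᵐ G ∂(condLaw n a b p), |ricci G (Sum.inl a) (Sum.inr b) - -2| ≤
      8 / M * |(leftCount a b G : ℝ) - M| + 8 / M * |(rightCount a b G : ℝ) - M| + 12 / M +
      4 / M * crossEdges G (Sum.inl a) (Sum.inr b) := by
    filter_upwards [condLaw_ae] with G hG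
    have := neg_two_le_ricci (sideColoring hG.2) hG.1
    rw [abs_of_nonneg (by linarith)]
    have := ricci_le_of_error hG.2 hG.1 hM
    linear_combination this
  have h3 := integral_abs_leftCount_sub_le (a := a) (b := b) hM
  have h4 := integral_abs_rightCount_sub_le (a := a) (b := b) hM
  rw [← hM'] at h3 h4
  refine (integral_mono_ae .of_finite .of_finite hb).trans ?_
  rw [integral_add .of_finite .of_finite, integral_add .of_finite .of_finite,
    integral_add .of_finite .of_finite,
    integral_const_mul, integral_const_mul, integral_const_mul,
    integral_const, probReal_univ, one_smul, h5]
  have eM : √M * √M = M := Real.mul_self_sqrt hM.le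
  have sM : 0 < √M := Real.sqrt_pos.2 hM
  calc _ ≤ 8 / M * √M + 8 / M * √M + 12 / M + 4 / M * (M * (((n - 1 : ℕ) : ℝ) * (p : ℝ) ^ 2)) := by
        gcongr
    _ = _ := by
        have e2 : 8 / M * √M = 8 / √M := by
          nth_rewrite 1 [← eM]
          field_simp
        have e3 : 4 / M * (M * (((n - 1 : ℕ) : ℝ) * (p : ℝ) ^ 2)) =
            4 * (((n - 1 : ℕ) : ℝ) * (p : ℝ) ^ 2) := by
          rw [← mul_assoc, div_mul_cancel₀ _ hM.ne']
        rw [e2, e3]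
        ring

end Moments

/-! ### Limits in the degenerate regimes, and weak convergence from point masses -/

section Limits

/-- Markov's inequality. The bound is required only eventually because the moment estimates need a
positive (n-1)p or (n-1)p², which fails at n = 1. -/
lemma tendstoInProbConst_of_integral_le {ι : Type*} {Ω : ι → Type*}
    {m : ∀ i, MeasurableSpace (Ω i)} [∀ i, Finite (Ω i)] [∀ i, DiscreteMeasurableSpace (Ω i)]
    {μ : ∀ i, Measure (Ω i)} [∀ i, IsFiniteMeasure (μ i)] {X : ∀ i, Ω i → ℝ} {l : Filter ι} {c : ℝ}
    {B : ι → ℝ} (hB : Tendsto B l (𝓝 0)) (h : ∀ᶠ i in l, ∫ ω, |X i ω - c| ∂(μ i) ≤ B i) :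
    TendstoInProbConst μ X l c := by
  intro ε hε
  have h1 : Tendsto (fun i => ENNReal.ofReal (B i / ε)) l (𝓝 0) := by
    simpa using ENNReal.tendsto_ofReal (hB.div_const ε)
  refine tendsto_of_tendsto_of_tendsto_of_le_of_le' tendsto_const_nhds h1
    (.of_forall fun _ => zero_le) (h.mono fun i hi => ?_)
  have := mul_meas_ge_le_integral_of_nonneg (μ := μ i) (f := fun ω => |X i ω - c|)
    (.of_forall fun ω => abs_nonneg _) .of_finite ε
  rw [← ofReal_measureReal]
  refine ENNReal.ofReal_le_ofReal ?_
  rw [le_div_iff₀ hε]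
  linarith

variable {p : ℕ+ → Set.Ioc (0 : ℝ) 1} {a b : (n : ℕ+) → Fin (n : ℕ)}

lemma cast_pred (n : ℕ+) : (((n : ℕ) - 1 : ℕ) : ℝ) = (n : ℝ) - 1 := by
  rw [Nat.cast_sub (Nat.one_le_iff_ne_zero.2 n.ne_zero), Nat.cast_one]

lemma tendstoInProbConst_zero
    (h : Tendsto (fun n : ℕ+ => (n : ℝ) * (p n : ℝ) ^ 2) atTop atTop) :
    TendstoInProbConst (fun n : ℕ+ => condLaw n (a n) (b n) (p n))
      (fun n G => ricci G (Sum.inl (a n)) (Sum.inr (b n))) atTop 0 := by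
  have ht : Tendsto (fun n : ℕ+ => (((n : ℕ) - 1 : ℕ) : ℝ) * (p n : ℝ) ^ 2) atTop atTop := by
    -- Passing from n to n - 1 costs p² ≤ 1.
    refine tendsto_atTop_mono (fun n => ?_) (tendsto_atTop_add_const_right atTop (-1) h)
    rw [cast_pred]
    nlinarith [(p n).2.1, (p n).2.2]
  have hM : Tendsto (fun n : ℕ+ => (((n : ℕ) - 1 : ℕ) : ℝ) * (p n : ℝ)) atTop atTop := by
    refine tendsto_atTop_mono (fun n => ?_) ht
    gcongr
    nlinarith [(p n).2.1, (p n).2.2]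
  have hB := (((Real.tendsto_sqrt_atTop.comp ht).const_div_atTop 4).add
    ((Real.tendsto_sqrt_atTop.comp hM).const_div_atTop 8)).add (hM.const_div_atTop 12)
  simp only [add_zero] at hB
  refine tendstoInProbConst_of_integral_le hB ?_
  filter_upwards [ht.eventually_gt_atTop 0] with n hn
  simpa using integral_abs_ricci_le hn

lemma tendstoInProbConst_neg_two
    (h1 : Tendsto (fun n : ℕ+ => (n : ℝ) * (p n : ℝ)) atTop atTop)
    (h2 : Tendsto (fun n : ℕ+ => (n : ℝ) * (p n : ℝ) ^ 2) atTop (𝓝 0)) :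
    TendstoInProbConst (fun n : ℕ+ => condLaw n (a n) (b n) (p n))
      (fun n G => ricci G (Sum.inl (a n)) (Sum.inr (b n))) atTop (-2) := by
  have hM : Tendsto (fun n : ℕ+ => (((n : ℕ) - 1 : ℕ) : ℝ) * (p n : ℝ)) atTop atTop := by
    refine tendsto_atTop_mono (fun n => ?_) (tendsto_atTop_add_const_right atTop (-1) h1)
    rw [cast_pred]
    nlinarith [(p n).2.1, (p n).2.2]
  have ht : Tendsto (fun n : ℕ+ => (((n : ℕ) - 1 : ℕ) : ℝ) * (p n : ℝ) ^ 2) atTop (𝓝 0) := by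
    refine squeeze_zero (fun n => by positivity) (fun n => ?_) h2
    rw [cast_pred]
    nlinarith [(p n).2.1, (p n).2.2]
  have hB := (((Real.tendsto_sqrt_atTop.comp hM).const_div_atTop 16).add
    (hM.const_div_atTop 12)).add (ht.const_mul 4)
  simp only [add_zero, mul_zero] at hB
  refine tendstoInProbConst_of_integral_le hB ?_
  filter_upwards [hM.eventually_gt_atTop 0] with n hn
  exact integral_abs_ricci_add_two_le hn

lemma isolatedEdge_of_count_eq_zero {n : ℕ} {a b : Fin n} {G : SimpleGraph (Fin n ⊕ Fin n)}
    (hG : G ≤ completeBipartiteGraph (Fin n) (Fin n)) (h : G.Adj (Sum.inl a) (Sum.inr b))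
    (h1 : leftCount a b G = 0) (h2 : rightCount a b G = 0) :
    IsolatedEdge G (Sum.inl a) (Sum.inr b) := by
  constructor
  · obtain ⟨u, hu⟩ := Set.ncard_eq_one.1 ((ncard_neighborSet_inl hG h).trans (by rw [h1]))
    have : Sum.inr b ∈ G.neighborSet (Sum.inl a) := h
    rw [hu] at this ⊢
    rw [Set.mem_singleton_iff.1 this]
  · obtain ⟨u, hu⟩ := Set.ncard_eq_one.1 ((ncard_neighborSet_inr hG h).trans (by rw [h2]))
    have : Sum.inl a ∈ G.neighborSet (Sum.inr b) := h.symm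
    rw [hu] at this ⊢
    rw [Set.mem_singleton_iff.1 this]

lemma ricci_eq_zero_of_isolatedEdge {V : Type*} [Fintype V] {G : SimpleGraph V} {x y : V}
    (c : G.Coloring Bool) (h : G.Adj x y) (hi : IsolatedEdge G x y) : ricci G x y = 0 := by
  refine le_antisymm (ricci_nonpos c h) ?_
  have := neg_two_mul_max_le_ricci c h
  rw [hi.1, hi.2] at this
  simpa using this

lemma integral_counts {n : ℕ} {a b : Fin n} {p : Set.Ioc (0 : ℝ) 1} :
    ∫ G, ((leftCount a b G : ℝ) + rightCount a b G) ∂(condLaw n a b p) =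
      2 * ((n - 1 : ℕ) * p) := by
  simp_rw [leftCount_eq, rightCount_eq]
  rw [integral_add .of_finite .of_finite, integral_finsetSum _ fun _ _ => .of_finite,
    integral_finsetSum _ fun _ _ => .of_finite,
    Finset.sum_congr rfl fun j hj => integral_ind (by simpa using hj),
    Finset.sum_congr rfl fun j hj => integral_ind (by simpa using hj),
    Finset.sum_const, Finset.sum_const, nsmul_eq_mul, nsmul_eq_mul, card_univ_erase,
    card_univ_erase]
  ring

lemma tendsto_measure_isolatedEdge
    (h : Tendsto (fun n : ℕ+ => (n : ℝ) * (p n : ℝ)) atTop (𝓝 0)) :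
    Tendsto (fun n : ℕ+ => condLaw n (a n) (b n) (p n)
      {G | IsolatedEdge G (Sum.inl (a n)) (Sum.inr (b n))}) atTop (𝓝 1) := by
  have key : ∀ n : ℕ+, 1 - ENNReal.ofReal (2 * ((n : ℝ) * p n)) ≤ condLaw n (a n) (b n) (p n)
      {G | IsolatedEdge G (Sum.inl (a n)) (Sum.inr (b n))} := by
    intro n
    set μ := condLaw n (a n) (b n) (p n) with hμ
    -- Markov at level 1 suffices: the counts are integers, so a sum below 1 means that both vanish.
    have h0 := mul_meas_ge_le_integral_of_nonneg (μ := μ)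
      (f := fun G => (leftCount (a n) (b n) G : ℝ) + rightCount (a n) (b n) G)
      (.of_forall fun ω => by positivity) .of_finite 1
    rw [one_mul, hμ, integral_counts, ← hμ, cast_pred] at h0
    have h1 : μ {G | 1 ≤ (leftCount (a n) (b n) G : ℝ) + rightCount (a n) (b n) G} ≤
        ENNReal.ofReal (2 * ((n : ℝ) * p n)) := by
      rw [← ofReal_measureReal]
      exact ENNReal.ofReal_le_ofReal (by linarith [(p n).2.1])
    have h2 : μ {G | IsolatedEdge G (Sum.inl (a n)) (Sum.inr (b n))}ᶜ ≤
        μ {G | 1 ≤ (leftCount (a n) (b n) G : ℝ) + rightCount (a n) (b n) G} := by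
      refine measure_mono_ae ?_
      filter_upwards [condLaw_ae] with G hG hiso
      by_contra hc
      have hc' : leftCount (a n) (b n) G + rightCount (a n) (b n) G < 1 := by
        have : (leftCount (a n) (b n) G : ℝ) + rightCount (a n) (b n) G < 1 := not_le.1 hc
        exact_mod_cast this
      exact hiso (isolatedEdge_of_count_eq_zero hG.2 hG.1 (by omega) (by omega))
    rw [prob_compl_eq_one_sub .of_discrete] at h2
    rw [tsub_le_iff_left, add_comm]
    have := h2.trans h1
    rwa [tsub_le_iff_left] at this
  refine tendsto_of_tendsto_of_tendsto_of_le_of_le ?_ tendsto_const_nhds key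
    fun n => prob_le_one
  have : Tendsto (fun n : ℕ+ => ENNReal.ofReal (2 * ((n : ℝ) * p n))) atTop (𝓝 0) := by
    simpa using ENNReal.tendsto_ofReal (h.const_mul 2)
  simpa using ENNReal.Tendsto.sub (tendsto_const_nhds (x := (1 : ℝ≥0∞))) this
    (.inl ENNReal.one_ne_top)

lemma tendsto_measure_ricci_eq_zero
    (h : Tendsto (fun n : ℕ+ => (n : ℝ) * (p n : ℝ)) atTop (𝓝 0)) :
    Tendsto (fun n : ℕ+ => condLaw n (a n) (b n) (p n)
      {G | ricci G (Sum.inl (a n)) (Sum.inr (b n)) = 0}) atTop (𝓝 1) := by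
  refine tendsto_of_tendsto_of_tendsto_of_le_of_le (tendsto_measure_isolatedEdge h)
    tendsto_const_nhds (fun n => measure_mono_ae ?_) fun n => prob_le_one
  filter_upwards [condLaw_ae] with G hG hi
  exact ricci_eq_zero_of_isolatedEdge (sideColoring hG.2) hG.1 hi

/-- On a countable discrete space, convergence of the point masses to those of a probability
measure implies weak convergence. -/
lemma tendsto_of_forall_singleton {E ι : Type*} [Countable E] [TopologicalSpace E]
    [DiscreteTopology E] [MeasurableSpace E] [BorelSpace E] {l : Filter ι}
    [l.IsCountablyGenerated] {ν : ι → ProbabilityMeasure E} {ν₀ : ProbabilityMeasure E}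
    (h : ∀ x, Tendsto (fun i => (ν i : Measure E) {x}) l (𝓝 ((ν₀ : Measure E) {x}))) :
    Tendsto ν l (𝓝 ν₀) := by
  rcases l.eq_or_neBot with rfl | hl
  · exact tendsto_bot
  -- By the portmanteau theorem a lower bound on open sets is enough. Writing measures as integrals
  -- of their point masses against counting measure, it is Fatou's lemma.
  refine tendsto_of_forall_isOpen_le_liminf' fun s _ => ?_
  have hs : ∀ ν : Measure E, ν s = ∫⁻ x in s, ν {x} ∂Measure.count := fun ν => by
    rw [← lintegral_indicator .of_discrete, lintegral_count,
      Measure.tsum_indicator_apply_singleton _ _ .of_discrete]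
  simp_rw [hs]
  calc ∫⁻ x in s, (ν₀ : Measure E) {x} ∂Measure.count
      = ∫⁻ x in s, liminf (fun i => (ν i : Measure E) {x}) l ∂Measure.count :=
        lintegral_congr fun x => (h x).liminf_eq.symm
    _ ≤ _ := lintegral_liminf_le fun i => .of_discrete

end Limits

/-! ### The Poisson regime -/

section Poisson

/-- The pairs at `a` and those at `b` are disjoint once (a, b) is removed, so the two counts are
independent binomials with n - 1 trials. The event is split according to the exact neighbour sets
`S` and `T`, each giving a box event. -/
lemma measureReal_counts {n : ℕ} {a b : Fin n} {p : Set.Ioc (0 : ℝ) 1} (k l : ℕ) :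
    (condLaw n a b p).real {G | leftCount a b G = k ∧ rightCount a b G = l} =
      ((n - 1).choose k * (p : ℝ) ^ k * (1 - (p : ℝ)) ^ (n - 1 - k)) *
        ((n - 1).choose l * (p : ℝ) ^ l * (1 - (p : ℝ)) ^ (n - 1 - l)) := by
  classical
  set U := Finset.univ.erase b with hU
  set V := Finset.univ.erase a with hV
  have hUc : U.card = n - 1 := by simp [hU]
  have hVc : V.card = n - 1 := by simp [hV]
  let L : SimpleGraph (Fin n ⊕ Fin n) → Finset (Fin n) :=
    fun G => {j ∈ U | G.Adj (Sum.inl a) (Sum.inr j)}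
  let R : SimpleGraph (Fin n ⊕ Fin n) → Finset (Fin n) :=
    fun G => {i ∈ V | G.Adj (Sum.inl i) (Sum.inr b)}
  have hL : ∀ G, leftCount a b G = (L G).card := fun G => by unfold leftCount; congr!
  have hR : ∀ G, rightCount a b G = (R G).card := fun G => by unfold rightCount; congr!
  have hunion : {G | leftCount a b G = k ∧ rightCount a b G = l} =
      ⋃ q ∈ U.powersetCard k ×ˢ V.powersetCard l, {G | L G = q.1 ∧ R G = q.2} := by
    ext G
    simp only [hL, hR, Set.mem_ofPred_eq, Set.mem_iUnion, Finset.mem_product,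
      Finset.mem_powersetCard, exists_prop, Prod.exists]
    constructor
    · rintro ⟨h1, h2⟩
      exact ⟨L G, R G, ⟨⟨Finset.filter_subset _ _, h1⟩, Finset.filter_subset _ _, h2⟩, rfl, rfl⟩
    · rintro ⟨S, T, ⟨⟨-, h1⟩, -, h2⟩, rfl, rfl⟩
      exact ⟨h1, h2⟩
  have hbox : ∀ q ∈ U.powersetCard k ×ˢ V.powersetCard l,
      (condLaw n a b p).real {G | L G = q.1 ∧ R G = q.2} =
        (p : ℝ) ^ (k + l) * (1 - (p : ℝ)) ^ ((n - 1 - k) + (n - 1 - l)) := by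
    rintro ⟨S, T⟩ hq
    obtain ⟨⟨hS, hSk⟩, hT, hTl⟩ : (S ⊆ U ∧ S.card = k) ∧ T ⊆ V ∧ T.card = l := by
      simpa [Finset.mem_powersetCard] using hq
    have hbU : b ∉ U := by simp [hU]
    have haV : a ∉ V := by simp [hV]
    have hset : {G | L G = S ∧ R G = T} = boxEvent (Fin n) (Fin n) (({a} ×ˢ S) ∪ (T ×ˢ {b}))
        (({a} ×ˢ (U \ S)) ∪ ((V \ T) ×ˢ {b})) := by
      ext G
      simp only [L, R, boxEvent, Set.mem_ofPred_eq, Finset.mem_union, Finset.mem_product,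
        Finset.mem_singleton, Finset.mem_sdiff, Finset.ext_iff, Finset.mem_filter, Prod.forall]
      constructor
      · rintro ⟨h1, h2⟩
        refine ⟨fun i j h => ?_, fun i j h => ?_⟩
        · rcases h with ⟨rfl, hj⟩ | ⟨hi, rfl⟩
          exacts [((h1 j).2 hj).2, ((h2 i).2 hi).2]
        · rcases h with ⟨rfl, hj⟩ | ⟨hi, rfl⟩
          exacts [fun h => hj.2 ((h1 j).1 ⟨hj.1, h⟩), fun h => hi.2 ((h2 i).1 ⟨hi.1, h⟩)]
      · rintro ⟨h1, h2⟩
        refine ⟨fun j => ⟨fun h => ?_, fun h => ⟨hS h, h1 a j (.inl ⟨rfl, h⟩)⟩⟩,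
          fun i => ⟨fun h => ?_, fun h => ⟨hT h, h1 i b (.inr ⟨h, rfl⟩)⟩⟩⟩
        · by_contra hj
          exact h2 a j (.inl ⟨rfl, h.1, hj⟩) h.2
        · by_contra hi
          exact h2 i b (.inr ⟨⟨h.1, hi⟩, rfl⟩) h.2
    have hd1 : Disjoint ({a} ×ˢ S) (T ×ˢ {b}) := by
      rw [Finset.disjoint_left]
      rintro ⟨i, j⟩ h h'
      simp only [Finset.mem_product, Finset.mem_singleton] at h h'
      exact haV (h.1 ▸ hT h'.1)
    have hd2 : Disjoint ({a} ×ˢ (U \ S)) ((V \ T) ×ˢ {b}) := by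
      rw [Finset.disjoint_left]
      rintro ⟨i, j⟩ h h'
      simp only [Finset.mem_product, Finset.mem_singleton, Finset.mem_sdiff] at h h'
      exact haV (h.1 ▸ h'.1.1)
    rw [hset, condLaw_boxEvent, Finset.card_union_of_disjoint hd1,
      Finset.card_union_of_disjoint hd2, Finset.card_product, Finset.card_product,
      Finset.card_product, Finset.card_product, Finset.card_singleton, Finset.card_singleton,
      Finset.card_sdiff_of_subset hS, Finset.card_sdiff_of_subset hT, hSk, hTl, hUc, hVc]
    · simp
    · rw [Finset.disjoint_left]
      rintro ⟨i, j⟩ h h'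
      simp only [Finset.mem_union, Finset.mem_product, Finset.mem_singleton,
        Finset.mem_sdiff] at h h'
      rcases h with ⟨rfl, hj⟩ | ⟨hi, rfl⟩ <;> rcases h' with ⟨h1, h2⟩ | ⟨h1, h2⟩
      · exact h2.2 hj
      · exact haV h1.1
      · exact hbU h2.1
      · exact h1.2 hi
    · simp only [Finset.mem_union, Finset.mem_product, Finset.mem_singleton, true_and, and_true]
      exact fun h => h.elim (fun h => hbU (hS h)) fun h => haV (hT h)
    · simp only [Finset.mem_union, Finset.mem_product, Finset.mem_singleton, true_and, and_true,
        Finset.mem_sdiff]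
      exact fun h => h.elim (fun h => hbU h.1) fun h => haV h.1
  rw [hunion, measureReal_biUnion_finset _ fun _ _ => .of_discrete, Finset.sum_congr rfl hbox,
    Finset.sum_const, Finset.card_product, Finset.card_powersetCard, Finset.card_powersetCard, hUc,
    hVc, nsmul_eq_mul]
  · push_cast
    ring
  · rintro ⟨S, T⟩ - ⟨S', T'⟩ - hne
    refine Set.disjoint_left.2 fun G h h' => hne ?_
    exact Prod.ext (h.1.symm.trans h'.1) (h.2.symm.trans h'.2)

/-- Random variables that coincide with high probability have the same limit in distribution. -/
lemma tendstoInDistribution_of_measure_ne {ι Ω' : Type*} {Ω : ι → Type*}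
    {m : ∀ i, MeasurableSpace (Ω i)} {μ : ∀ i, Measure (Ω i)} [∀ i, IsProbabilityMeasure (μ i)]
    {m' : MeasurableSpace Ω'} {μ' : Measure Ω'} [IsProbabilityMeasure μ']
    {X Y : ∀ i, Ω i → ℝ} {Z : Ω' → ℝ} {l : Filter ι}
    (hX : ∀ i, Measurable (X i)) (hY : ∀ i, Measurable (Y i))
    (h : TendstoInDistribution Y l Z μ μ')
    (hXY : Tendsto (fun i => (μ i).real {ω | X i ω ≠ Y i ω}) l (𝓝 0)) :
    TendstoInDistribution X l Z μ μ' := by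
  refine ⟨fun i => (hX i).aemeasurable, h.aemeasurable_limit, ?_⟩
  refine ProbabilityMeasure.tendsto_iff_forall_integral_tendsto.2 fun f => ?_
  have hf := ProbabilityMeasure.tendsto_iff_forall_integral_tendsto.1 h.tendsto f
  simp only [ProbabilityMeasure.coe_mk] at hf ⊢
  rw [← sub_zero (∫ x, f x ∂(μ'.map Z))]
  have hdiff : Tendsto (fun i => ∫ x, f x ∂((μ i).map (Y i)) - ∫ x, f x ∂((μ i).map (X i))) l
      (𝓝 0) := by
    have hlim := hXY.const_mul (2 * ‖f‖)
    rw [mul_zero] at hlim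
    refine squeeze_zero_norm (fun i => ?_) hlim
    have hi : ∀ {W : Ω i → ℝ}, Measurable W → Integrable (fun ω => f (W ω)) (μ i) := fun hW =>
      .of_bound (f.continuous.measurable.comp hW).aestronglyMeasurable ‖f‖
        (.of_forall fun ω => f.norm_coe_le_norm _)
    have hmeas : MeasurableSet {ω | X i ω ≠ Y i ω} := (measurableSet_eq_fun (hX i) (hY i)).compl
    rw [integral_map (hX i).aemeasurable f.continuous.aestronglyMeasurable,
      integral_map (hY i).aemeasurable f.continuous.aestronglyMeasurable,
      ← integral_sub (hi (hY i)) (hi (hX i))]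
    refine (norm_integral_le_integral_norm _).trans ?_
    -- The integrand vanishes where the variables agree and is at most 2‖f‖ elsewhere.
    calc ∫ ω, ‖f (Y i ω) - f (X i ω)‖ ∂(μ i)
        ≤ ∫ ω, {ω | X i ω ≠ Y i ω}.indicator (fun _ => 2 * ‖f‖) ω ∂(μ i) := by
          refine integral_mono ((hi (hY i)).sub (hi (hX i))).norm
            ((integrable_const _).indicator hmeas) fun ω => ?_
          by_cases hω : X i ω = Y i ω
          · simp [hω]
          · rw [Set.indicator_of_mem hω]
            have := norm_sub_le (f (Y i ω)) (f (X i ω))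
            linarith [f.norm_coe_le_norm (Y i ω), f.norm_coe_le_norm (X i ω)]
      _ = 2 * ‖f‖ * (μ i).real {ω | X i ω ≠ Y i ω} := by
          rw [integral_indicator_const _ hmeas, smul_eq_mul, mul_comm]
  refine (hf.sub hdiff).congr fun i => ?_
  ring

variable {p : ℕ+ → Set.Ioc (0 : ℝ) 1} {a b : (n : ℕ+) → Fin (n : ℕ)} {r : ℝ≥0}

lemma tendsto_natPred_atTop : Tendsto PNat.natPred atTop atTop := by
  exact OrderIso.pnatIsoNat.tendsto_atTop

lemma tendsto_binomial_poisson
    (h : Tendsto (fun n : ℕ+ => (n : ℝ) * (p n : ℝ)) atTop (𝓝 (r : ℝ))) (k : ℕ) :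
    Tendsto (fun n : ℕ+ => ((n : ℕ) - 1).choose k * (p n : ℝ) ^ k *
      (1 - (p n : ℝ)) ^ ((n : ℕ) - 1 - k)) atTop (𝓝 ((poissonMeasure r).real {k})) := by
  have hp0 : Tendsto (fun n : ℕ+ => (p n : ℝ)) atTop (𝓝 0) := by
    have : Tendsto (fun n : ℕ+ => ((n : ℝ))⁻¹) atTop (𝓝 0) :=
      tendsto_inv_atTop_zero.comp (tendsto_natCast_atTop_atTop.comp tendsto_PNat_val_atTop_atTop)
    have := h.mul this
    rw [mul_zero] at this
    refine this.congr fun n => ?_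
    have : (n : ℝ) ≠ 0 := by exact_mod_cast n.ne_zero
    field_simp
  -- With m = n - 1 trials the mean is np - p, which has the same limit because p → 0.
  have hr : Tendsto (fun m : ℕ => (m : ℝ) * (p m.succPNat : ℝ)) atTop (𝓝 (r : ℝ)) := by
    have h1 : Tendsto Nat.succPNat atTop atTop := OrderIso.pnatIsoNat.symm.tendsto_atTop
    have := (h.sub hp0).comp h1
    rw [sub_zero] at this
    refine this.congr fun m => ?_
    simp
    ring
  have := (tendsto_choose_mul_pow_of_tendsto_mul_atTop k hr).comp tendsto_natPred_atTop
  rw [poissonMeasure_real_singleton]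
  refine this.congr fun n => ?_
  simp only [Function.comp_apply, PNat.succPNat_natPred]
  rfl

/-- The quantity (np)³/n = n²p³ dominates the expected number of cross edges. -/
lemma tendsto_mul_pow_three_div
    (h : Tendsto (fun n : ℕ+ => (n : ℝ) * (p n : ℝ)) atTop (𝓝 (r : ℝ))) :
    Tendsto (fun n : ℕ+ => ((n : ℝ) * (p n : ℝ)) ^ 3 / n) atTop (𝓝 0) := by
  exact (h.pow 3).div_atTop (tendsto_natCast_atTop_atTop.comp tendsto_PNat_val_atTop_atTop)

lemma one_le_crossEdges_of_ne_zero {V : Type*} [Fintype V] {G : SimpleGraph V} {x y : V}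
    (h : crossEdges G x y ≠ 0) : 1 ≤ crossEdges G x y := by
  classical
  have : ∃ k : ℕ, crossEdges G x y = k := by
    refine ⟨∑ u, ∑ v, if u ≠ y ∧ v ≠ x ∧ G.Adj x u ∧ G.Adj u v ∧ G.Adj y v then 1 else 0, ?_⟩
    unfold crossEdges
    push_cast
    congr!
  obtain ⟨k, hk⟩ := this
  rw [hk] at h ⊢
  exact_mod_cast Nat.one_le_iff_ne_zero.2 (by exact_mod_cast h)

lemma tendstoInDistribution_ricci
    (h : Tendsto (fun n : ℕ+ => (n : ℝ) * (p n : ℝ)) atTop (𝓝 (r : ℝ)))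
    {Ω : Type*} [MeasurableSpace Ω] {P : Measure Ω} [IsProbabilityMeasure P]
    {X₁ X₂ : Ω → ℕ} (h₁ : HasLaw X₁ (poissonMeasure r) P) (h₂ : HasLaw X₂ (poissonMeasure r) P)
    (hind : IndepFun X₁ X₂ P) :
    TendstoInDistribution
      (fun (n : ℕ+) (G : SimpleGraph (Fin (n : ℕ) ⊕ Fin (n : ℕ))) =>
        ricci G (Sum.inl (a n)) (Sum.inr (b n))) atTop
      (fun ω => -2 * max (1 - 1 / (1 + (X₁ ω : ℝ)) - 1 / (1 + (X₂ ω : ℝ))) 0)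
      (fun n : ℕ+ => condLaw n (a n) (b n) (p n)) P := by
  have hlaw := hind.hasLaw_prod h₁ h₂
  have hpair : TendstoInDistribution
      (fun (n : ℕ+) (G : SimpleGraph (Fin (n : ℕ) ⊕ Fin (n : ℕ))) =>
        (leftCount (a n) (b n) G, rightCount (a n) (b n) G)) atTop
      (fun ω => (X₁ ω, X₂ ω)) (fun n : ℕ+ => condLaw n (a n) (b n) (p n)) P := by
    refine ⟨fun n => Measurable.of_discrete.aemeasurable, hlaw.aemeasurable,
      tendsto_of_forall_singleton ?_⟩
    rintro ⟨k, l⟩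
    simp only [ProbabilityMeasure.coe_mk]
    rw [hlaw.map_eq, ← Set.singleton_prod_singleton, Measure.prod_prod, ← ofReal_measureReal,
      ← ofReal_measureReal, ← ENNReal.ofReal_mul measureReal_nonneg]
    refine (ENNReal.tendsto_ofReal ((tendsto_binomial_poisson h k).mul
      (tendsto_binomial_poisson h l))).congr fun n => ?_
    rw [← measureReal_counts (a := a n) (b := b n), ofReal_measureReal,
      Measure.map_apply .of_discrete .of_discrete]
    congr 1
  -- The counts take values in a discrete space, so any function of them is continuous. It remains
  -- to replace this function by the curvature, which differs from it only if there is a cross edge.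
  have hlim := hpair.continuous_comp
    (g := fun q : ℕ × ℕ => -2 * max (1 - 1 / (1 + (q.1 : ℝ)) - 1 / (1 + (q.2 : ℝ))) 0)
    continuous_of_discreteTopology
  refine tendstoInDistribution_of_measure_ne (fun n => .of_discrete) (fun n => .of_discrete) hlim ?_
  refine squeeze_zero (fun n => measureReal_nonneg) (fun n => ?_) (tendsto_mul_pow_three_div h)
  set μ := condLaw n (a n) (b n) (p n) with hμ
  have h0 := mul_meas_ge_le_integral_of_nonneg (μ := μ)
    (f := fun G => crossEdges G (Sum.inl (a n)) (Sum.inr (b n)))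
    (.of_forall fun G => crossEdges_nonneg _ _ _) .of_finite 1
  rw [one_mul, hμ, integral_crossEdges, ← hμ, cast_pred] at h0
  have h1 : μ.real {G | ricci G (Sum.inl (a n)) (Sum.inr (b n)) ≠
      ((fun q : ℕ × ℕ => -2 * max (1 - 1 / (1 + (q.1 : ℝ)) - 1 / (1 + (q.2 : ℝ))) 0) ∘
        fun G => (leftCount (a n) (b n) G, rightCount (a n) (b n) G)) G} ≤
      μ.real {G | 1 ≤ crossEdges G (Sum.inl (a n)) (Sum.inr (b n))} := by
    refine ENNReal.toReal_mono (measure_ne_top _ _) (measure_mono_ae ?_)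
    filter_upwards [condLaw_ae] with G hG hne
    refine one_le_crossEdges_of_ne_zero fun h0 => hne ?_
    exact ricci_eq_of_crossEdges_eq_zero hG.2 hG.1 h0
  refine (h1.trans h0).trans ?_
  have hn : (1 : ℝ) ≤ n := by exact_mod_cast n.pos
  have hp : (0 : ℝ) ≤ p n := (p n).2.1.le
  calc ((n : ℝ) - 1) ^ 2 * (p n : ℝ) ^ 3 ≤ (n : ℝ) ^ 2 * (p n : ℝ) ^ 3 := by
        gcongr
        linarith
    _ = _ := by
        field_simp

end Poisson

end RicciRandomBipartite

theorem mainTheorem6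
    (p : ℕ+ → Set.Ioc (0 : ℝ) 1) (a b : (n : ℕ+) → Fin (n : ℕ)) :
    (Tendsto (fun n : ℕ+ => (n : ℝ) * (p n : ℝ)) atTop (𝓝 0) →
      Tendsto (fun n : ℕ+ => RicciRandomBipartite.condLaw n (a n) (b n) (p n)
        {G | RicciRandomBipartite.IsolatedEdge G (Sum.inl (a n)) (Sum.inr (b n))})
        atTop (𝓝 1) ∧
      Tendsto (fun n : ℕ+ => RicciRandomBipartite.condLaw n (a n) (b n) (p n)
        {G | RicciRandomBipartite.ricci G (Sum.inl (a n)) (Sum.inr (b n)) = 0})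
        atTop (𝓝 1)) ∧
    (∀ r : ℝ≥0, 0 < r →
      Tendsto (fun n : ℕ+ => (n : ℝ) * (p n : ℝ)) atTop (𝓝 (r : ℝ)) →
      ∀ (Ω : Type*) [MeasurableSpace Ω] (P : Measure Ω) [IsProbabilityMeasure P]
        (X₁ X₂ : Ω → ℕ), HasLaw X₁ (poissonMeasure r) P → HasLaw X₂ (poissonMeasure r) P →
        IndepFun X₁ X₂ P →
        TendstoInDistribution
          (fun (n : ℕ+) (G : SimpleGraph (Fin (n : ℕ) ⊕ Fin (n : ℕ))) =>
            RicciRandomBipartite.ricci G (Sum.inl (a n)) (Sum.inr (b n)))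
          atTop
          (fun ω => -2 * max (1 - 1 / (1 + (X₁ ω : ℝ)) - 1 / (1 + (X₂ ω : ℝ))) 0)
          (fun n : ℕ+ => RicciRandomBipartite.condLaw n (a n) (b n) (p n)) P) ∧
    (Tendsto (fun n : ℕ+ => (n : ℝ) * (p n : ℝ)) atTop atTop →
      Tendsto (fun n : ℕ+ => (n : ℝ) * (p n : ℝ) ^ 2) atTop (𝓝 0) →
      RicciRandomBipartite.TendstoInProbConst
        (fun n : ℕ+ => RicciRandomBipartite.condLaw n (a n) (b n) (p n))
        (fun n G => RicciRandomBipartite.ricci G (Sum.inl (a n)) (Sum.inr (b n)))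
        atTop (-2)) ∧
    (Tendsto (fun n : ℕ+ => (n : ℝ) * (p n : ℝ) ^ 2) atTop atTop →
      RicciRandomBipartite.TendstoInProbConst
        (fun n : ℕ+ => RicciRandomBipartite.condLaw n (a n) (b n) (p n))
        (fun n G => RicciRandomBipartite.ricci G (Sum.inl (a n)) (Sum.inr (b n)))
        atTop 0) := by
  exact ⟨fun h => ⟨RicciRandomBipartite.tendsto_measure_isolatedEdge h,
      RicciRandomBipartite.tendsto_measure_ricci_eq_zero h⟩,
    fun r _ h Ω _ P _ X₁ X₂ h₁ h₂ hind =>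
      RicciRandomBipartite.tendstoInDistribution_ricci h h₁ h₂ hind,
    fun h1 h2 => RicciRandomBipartite.tendstoInProbConst_neg_two h1 h2,
    fun h => RicciRandomBipartite.tendstoInProbConst_zero h⟩
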